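/- Let $n\ge 3$ and $\hbar,\varepsilon\in\mathbb C$. For $m\geq 3$ let $Y(m)=Y_{\hbar,\varepsilon}(\widehat{\mathfrak{sl}}(m))$ be the associative $\mathbb C$-algebra generated by $X^{\pm}_{i,r},H_{i,r}$ ($i\in\mathbb Z/m\mathbb Z=\{0,\dots,m-1\}$, $r\in\{0,1\}$) subject to the following relations, where $\{x,y\}=xy+yx$, $\widetilde H_{i,1}=H_{i,1}-\frac{\hbar}{2}H_{i,0}^2$, $a_{ij}=2$ if $i=j$, $a_{ij}=-1$ if $j=i\pm1$, $a_{ij}=0$ otherwise: $$[H_{i,r},H_{j,s}]=0,\quad [X^+_{i,0},X^-_{j,0}]=\delta_{ij}H_{i,0},\quad [X^+_{i,1},X^-_{j,0}]=\delta_{ij}H_{i,1}=[X^+_{i,0},X^-_{j,1}],\quad [H_{i,0},X^\pm_{j,r}]=\pm a_{ij}X^\pm_{j,r},$$ $$[\widetilde H_{i,1},X^\pm_{j,0}]=\pm a_{ij}X^\pm_{j,1}\ \text{ and }\ [X^\pm_{i,1},X^\pm_{j,0}]-[X^\pm_{i,0},X^\pm_{j,1}]=\pm a_{ij}\tfrac{\hbar}{2}\{X^\pm_{i,0},X^\pm_{j,0}\}\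 \text{ if }(i,j)\ne(0,m-1),(m-1,0),$$ $$[\widetilde H_{0,1},X^\pm_{m-1,0}]=\mp\big(X^\pm_{m-1,1}+(\varepsilon+\tfrac m2\hbar)X^\pm_{m-1,0}\big),\quad [\widetilde H_{m-1,1},X^\pm_{0,0}]=\mp\big(X^\pm_{0,1}-(\varepsilon+\tfrac m2\hbar)X^\pm_{0,0}\big),$$ $$[X^\pm_{0,1},X^\pm_{m-1,0}]-[X^\pm_{0,0},X^\pm_{m-1,1}]=\mp\tfrac{\hbar}{2}\{X^\pm_{0,0},X^\pm_{m-1,0}\}+(\varepsilon+\tfrac m2\hbar)[X^\pm_{0,0},X^\pm_{m-1,0}],$$ $$(\operatorname{ad}X^\pm_{i,0})^{1+|a_{ij}|}(X^\pm_{j,0})=0\ \text{ if }i\ne j.$$ For $1\le i\ne j\le m$ and $s\in\mathbb Z$ write $E_{i,j}t^s$ also for the image of this element of $\widehat{\mathfrak{sl}}(m)$ under the natural homomorphism $U(\widehat{\mathfrak{sl}}(m))\to Y(m)$, which sends $E_{k,k+1}\mapsto X^+_{k,0}$ and $E_{k+1,k}\mapsto X^-_{k,0}$ ($1\le k\le m-1$),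 $E_{m,1}t\mapsto X^+_{0,0}$, $E_{1,m}t^{-1}\mapsto X^-_{0,0}$. Grade $Y(m)=\bigoplus_d Y(m)_d$ by $\deg X^\pm_{0,r}=\pm1$, all other generators having degree $0$, and let $\widetilde Y(m)=\bigoplus_d\varprojlim_N Y(m)_d\big/\sum_{r\ge N}Y(m)_{d-r}Y(m)_r$ be the degreewise completion. Let $\Psi\colon Y(n)\to\widetilde Y(n+1)$ be the algebra homomorphism determined by $$\Psi(H_{0,0})=H_{0,0}+H_{n,0},\quad \Psi(X^+_{0,0})=E_{n,1}t,\quad \Psi(X^-_{0,0})=E_{1,n}t^{-1}$$ and, for $1\le i\le n-1$, $$\Psi(H_{i,0})=H_{i,0},\quad \Psi(X^+_{i,0})=E_{i,i+1},\quad \Psi(X^-_{i,0})=E_{i+1,i},$$ $$\Psi(H_{i,1})=H_{i,1}-\hbar\sum_{s\ge0}E_{i,n+1}t^{-s-1}E_{n+1,i}t^{s+1}+\hbar\sum_{s\ge0}E_{i+1,n+1}t^{-s-1}E_{n+1,i+1}t^{s+1},$$ $$\Psi(X^+_{i,1})=X^+_{i,1}-\hbar\sum_{s\ge0}E_{i,n+1}t^{-s-1}E_{n+1,i+1}t^{s+1},\quad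 \Psi(X^-_{i,1})=X^-_{i,1}-\hbar\sum_{s\ge0}E_{i+1,n+1}t^{-s-1}E_{n+1,i}t^{s+1}.$$ Then the infinite sums below converge in $\widetilde Y(n+1)$ and $$\Psi(X^+_{0,1})=[X^+_{n,0},X^+_{0,1}]-\hbar\sum_{s\ge0}E_{n,n+1}t^{-s}E_{n+1,1}t^{s+1},$$ $$\Psi(X^-_{0,1})=[X^-_{0,1},X^-_{n,0}]-\hbar\sum_{s\ge0}E_{1,n+1}t^{-s-1}E_{n+1,n}t^{s},$$ $$\Psi(H_{0,1})=H_{0,1}+H_{n,1}+\big(\varepsilon+\tfrac{\hbar}{2}n\big)H_{n,0}+\hbar H_{n,0}H_{0,0}-\hbar\sum_{s\ge0}E_{n,n+1}t^{-s-1}E_{n+1,n}t^{s+1}+\hbar\sum_{s\ge0}E_{1,n+1}t^{-s-1}E_{n+1,1}t^{s+1},$$ $$\Psi(\widetilde H_{0,1})=\widetilde H_{0,1}+\widetilde H_{n,1}+\big(\varepsilon+\tfrac{\hbar}{2}n\big)H_{n,0}-\hbar\sum_{s\ge0}E_{n,n+1}t^{-s-1}E_{n+1,n}t^{s+1}+\hbar\sum_{s\ge0}E_{1,n+1}t^{-s-1}E_{n+1,1}t^{s+1}.$$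 -/

import Mathlib

open Topology

namespace AffineYangian

noncomputable section

/-! ### The affine Yangian, by generators and relations -/

/-- Generators: `X σ i r` is `X^±_{i,r}` (`σ = 1` for `+`, `σ = -1` for `-`) and `H i r` is
`H_{i,r}`, for a node `i ∈ ℤ/nℤ = {0, …, n-1}` and a level `r ∈ {0, 1}`. -/
inductive Gen (n : ℕ) : Type
  | X (σ : ℤˣ) (i : ZMod n) (r : Fin 2) : Gen n
  | H (i : ZMod n) (r : Fin 2) : Gen n

/-- The Cartan matrix of type `A_{n-1}^{(1)}`. -/
def cartan (n : ℕ) (i j : ZMod n) : ℤ :=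
  if i = j then 2 else if j = i + 1 ∨ j = i - 1 then -1 else 0

/-- The sign `±1` as a complex number. -/
def sgn (σ : ℤˣ) : ℂ := ((σ : ℤ) : ℂ)

section FreeAlgebra

variable {n : ℕ}

/-- The generator `X^±_{i,r}` in the free algebra. -/
def fX (σ : ℤˣ) (i : ZMod n) (r : Fin 2) : FreeAlgebra ℂ (Gen n) := FreeAlgebra.ι ℂ (Gen.X σ i r)

/-- The generator `H_{i,r}` in the free algebra. -/
def fH (i : ZMod n) (r : Fin 2) : FreeAlgebra ℂ (Gen n) := FreeAlgebra.ι ℂ (Gen.H i r)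

/-- `H̃_{i,1} = H_{i,1} - (ℏ/2) H_{i,0}²` in the free algebra. -/
def fHt (ℏ : ℂ) (i : ZMod n) : FreeAlgebra ℂ (Gen n) := fH i 1 - (ℏ / 2) • fH i 0 ^ 2

end FreeAlgebra

/-- The defining relations. The node `n - 1` is written `-1` in `ℤ/nℤ`; `⁅x, y⁆ = x y - y x`, and
the anticommutator `{x, y}` is written out as `x y + y x`. -/
inductive Relation (n : ℕ) (ℏ ε : ℂ) : FreeAlgebra ℂ (Gen n) → FreeAlgebra ℂ (Gen n) → Prop
  | HH (i j : ZMod n) (r s : Fin 2) : Relation n ℏ ε ⁅fH i r, fH j s⁆ 0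
  | XX00 (i j : ZMod n) : Relation n ℏ ε ⁅fX 1 i 0, fX (-1) j 0⁆ (if i = j then fH i 0 else 0)
  | XX10 (i j : ZMod n) : Relation n ℏ ε ⁅fX 1 i 1, fX (-1) j 0⁆ (if i = j then fH i 1 else 0)
  | XX01 (i j : ZMod n) : Relation n ℏ ε ⁅fX 1 i 0, fX (-1) j 1⁆ (if i = j then fH i 1 else 0)
  | HX (σ : ℤˣ) (i j : ZMod n) (r : Fin 2) :
      Relation n ℏ ε ⁅fH i 0, fX σ j r⁆ ((sgn σ * (cartan n i j : ℂ)) • fX σ j r)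
  | HtX (σ : ℤˣ) (i j : ZMod n) (h : ¬ (i = 0 ∧ j = -1)) (h' : ¬ (i = -1 ∧ j = 0)) :
      Relation n ℏ ε ⁅fHt ℏ i, fX σ j 0⁆ ((sgn σ * (cartan n i j : ℂ)) • fX σ j 1)
  | HtX_zero_last (σ : ℤˣ) :
      Relation n ℏ ε ⁅fHt ℏ (0 : ZMod n), fX σ (-1 : ZMod n) 0⁆
        (-(sgn σ • (fX σ (-1 : ZMod n) 1 + (ε + (n : ℂ) / 2 * ℏ) • fX σ (-1 : ZMod n) 0)))
  | HtX_last_zero (σ : ℤˣ) :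
      Relation n ℏ ε ⁅fHt ℏ (-1 : ZMod n), fX σ (0 : ZMod n) 0⁆
        (-(sgn σ • (fX σ (0 : ZMod n) 1 - (ε + (n : ℂ) / 2 * ℏ) • fX σ (0 : ZMod n) 0)))
  | XX (σ : ℤˣ) (i j : ZMod n) (h : ¬ (i = 0 ∧ j = -1)) (h' : ¬ (i = -1 ∧ j = 0)) :
      Relation n ℏ ε (⁅fX σ i 1, fX σ j 0⁆ - ⁅fX σ i 0, fX σ j 1⁆)
        ((sgn σ * (cartan n i j : ℂ) * (ℏ / 2)) • (fX σ i 0 * fX σ j 0 + fX σ j 0 * fX σ i 0))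
  | XX_zero_last (σ : ℤˣ) :
      Relation n ℏ ε (⁅fX σ (0 : ZMod n) 1, fX σ (-1 : ZMod n) 0⁆ - ⁅fX σ (0 : ZMod n) 0, fX σ (-1 : ZMod n) 1⁆)
        (-((sgn σ * (ℏ / 2)) • (fX σ (0 : ZMod n) 0 * fX σ (-1 : ZMod n) 0 + fX σ (-1 : ZMod n) 0 * fX σ (0 : ZMod n) 0))
          + (ε + (n : ℂ) / 2 * ℏ) • ⁅fX σ (0 : ZMod n) 0, fX σ (-1 : ZMod n) 0⁆)
  | serre (σ : ℤˣ) (i j : ZMod n) (h : i ≠ j) :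
      Relation n ℏ ε ((fun y => ⁅fX σ i 0, y⁆)^[1 + (cartan n i j).natAbs] (fX σ j 0)) 0

/-- The affine Yangian `Y_{ℏ,ε}(ŝl(n))` (used for `n ≥ 3`). -/
def Yangian (n : ℕ) (ℏ ε : ℂ) : Type := RingQuot (Relation n ℏ ε)

variable {n : ℕ} {ℏ ε : ℂ}

instance : Ring (Yangian n ℏ ε) := inferInstanceAs (Ring (RingQuot (Relation n ℏ ε)))

instance : Algebra ℂ (Yangian n ℏ ε) := inferInstanceAs (Algebra ℂ (RingQuot (Relation n ℏ ε)))

/-- The quotient map from the free algebra. -/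
def mk : FreeAlgebra ℂ (Gen n) →ₐ[ℂ] Yangian n ℏ ε := RingQuot.mkAlgHom ℂ (Relation n ℏ ε)

/-- The class of a generator. -/
def gen (g : Gen n) : Yangian n ℏ ε := mk (FreeAlgebra.ι ℂ g)

/-- `X^±_{i,r}`. -/
def X (σ : ℤˣ) (i : ZMod n) (r : Fin 2) : Yangian n ℏ ε := gen (Gen.X σ i r)

/-- `H_{i,r}`. -/
def H (i : ZMod n) (r : Fin 2) : Yangian n ℏ ε := gen (Gen.H i r)

/-- `H̃_{i,1} = H_{i,1} - (ℏ/2) H_{i,0}²`. -/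
def Ht (i : ZMod n) : Yangian n ℏ ε := H i 1 - (ℏ / 2) • H i 0 ^ 2

/-! ### The image of `ŝl(n)`

The natural map from `ŝl(n)` to the Yangian sends the Chevalley generators
`E_{k,k+1}`, `E_{k+1,k}` (`1 ≤ k ≤ n-1`), `E_{n,1} t`, `E_{1,n} t⁻¹` to `X⁺_{k,0}`, `X⁻_{k,0}`,
`X⁺_{0,0}`, `X⁻_{0,0}`. With the periodic notation `E_{i, j + s n} := E_{i,j} t^s`
(and `E_{i + n, j + n} = E_{i,j}`) these are `E_{k,k+1}` and `E_{k+1,k}` for `k ∈ ℤ/nℤ`, and every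
real root vector is an iterated bracket of them: in `ŝl(n)`, for integers `a < b`, `a ≢ b mod n`,
`E_{a,b} = [E_{a,a+1}, [E_{a+1,a+2}, […, E_{b-1,b}]]]` and
`E_{b,a} = [E_{b,b-1}, [E_{b-1,b-2}, […, E_{a+1,a}]]]`. -/

/-- `[X⁺_{a,0}, [X⁺_{a+1,0}, […, X⁺_{a+m,0}]]]`, the image of `E_{a, a+m+1}`. -/
def posRoot (a : ZMod n) : ℕ → Yangian n ℏ ε
  | 0 => X 1 a 0
  | m + 1 => ⁅(X 1 a 0 : Yangian n ℏ ε), posRoot (a + 1) m⁆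

/-- `[X⁻_{a+m,0}, [X⁻_{a+m-1,0}, […, X⁻_{a,0}]]]`, the image of `E_{a+m+1, a}`. -/
def negRoot (a : ZMod n) : ℕ → Yangian n ℏ ε
  | 0 => X (-1) a 0
  | m + 1 => ⁅(X (-1) (a + ((m + 1 : ℕ) : ZMod n)) 0 : Yangian n ℏ ε), negRoot a m⁆

/-- The image of `E_{i,j} t^s` in the Yangian, for `1 ≤ i, j ≤ n` with `i ≠ j` and `s ∈ ℤ`. -/
def E (i j : ℕ) (s : ℤ) : Yangian n ℏ ε :=
  let b : ℤ := j + s * n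
  if (i : ℤ) < b then posRoot (i : ZMod n) (b - i - 1).toNat
  else negRoot (b : ZMod n) (i - b - 1).toNat

/-! ### The degreewise completion -/

/-- `deg H_{i,r} = 0`, `deg X^±_{0,r} = ±1`, `deg X^±_{i,r} = 0` for `i ≠ 0`. -/
def deg : Gen n → ℤ
  | Gen.X σ i _ => if i = 0 then (σ : ℤ) else 0
  | Gen.H _ _ => 0

/-- The component `Y_d` of degree `d`: the span of the monomials of degree `d`. -/
def homog (n : ℕ) (ℏ ε : ℂ) (d : ℤ) : Submodule ℂ (Yangian n ℏ ε) :=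
  Submodule.span ℂ {y | ∃ l : List (Gen n), (l.map deg).sum = d ∧ (l.map gen).prod = y}

/-- The left ideal `Y · ⋃_{r ≥ N} Y_r`. Its component of degree `d` is
`∑_{r ≥ N} Y_{d-r} Y_r`. -/
def leftIdeal (n : ℕ) (ℏ ε : ℂ) (N : ℕ) : Ideal (Yangian n ℏ ε) :=
  Ideal.span (⋃ r : {r : ℤ // (N : ℤ) ≤ r}, (homog n ℏ ε r : Set (Yangian n ℏ ε)))

theorem leftIdeal_antitone {M N : ℕ} (h : M ≤ N) : leftIdeal n ℏ ε N ≤ leftIdeal n ℏ ε M := by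
  refine Ideal.span_mono (Set.iUnion_subset fun r => ?_)
  exact Set.subset_iUnion_of_subset ⟨r.1, le_trans (by exact_mod_cast h) r.2⟩ subset_rfl

theorem gen_induction {p : Yangian n ℏ ε → Prop} (hg : ∀ g, p (gen g))
    (hc : ∀ c : ℂ, p (algebraMap ℂ _ c)) (ha : ∀ x y, p x → p y → p (x + y))
    (hm : ∀ x y, p x → p y → p (x * y)) (x : Yangian n ℏ ε) : p x := by
  obtain ⟨y, rfl⟩ := RingQuot.mkAlgHom_surjective ℂ (Relation n ℏ ε) x
  change p (mk y)
  induction y using FreeAlgebra.induction with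
  | grade0 r => rw [AlgHom.commutes]; exact hc r
  | grade1 g => exact hg g
  | mul a b ha' hb' => rw [map_mul]; exact hm _ _ ha' hb'
  | add a b ha' hb' => rw [map_add]; exact ha _ _ ha' hb'

theorem homog_mul_gen {d : ℤ} {y : Yangian n ℏ ε} (hy : y ∈ homog n ℏ ε d) (g : Gen n) :
    y * gen g ∈ homog n ℏ ε (d + deg g) := by
  induction hy using Submodule.span_induction with
  | mem y hy =>
    obtain ⟨l, hl, rfl⟩ := hy
    exact Submodule.subset_span ⟨l ++ [g], by simp [hl], by simp⟩
  | zero => rw [zero_mul]; exact Submodule.zero_mem _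
  | add a b _ _ ha hb => rw [add_mul]; exact Submodule.add_mem _ ha hb
  | smul c a _ ha => rw [smul_mul_assoc]; exact Submodule.smul_mem _ _ ha

theorem neg_one_le_deg (g : Gen n) : -1 ≤ deg g := by
  cases g with
  | X σ i r =>
    rcases Int.units_eq_one_or σ with rfl | rfl <;> simp only [deg] <;> split_ifs <;> simp
  | H i r => simp [deg]

theorem leftIdeal_mul_right (x : Yangian n ℏ ε) :
    ∀ N : ℕ, ∃ M : ℕ, ∀ y ∈ leftIdeal n ℏ ε M, y * x ∈ leftIdeal n ℏ ε N := by
  induction x using gen_induction with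
  | hg g =>
    intro N
    refine ⟨N + 1, fun y hy => ?_⟩
    induction hy using Submodule.span_induction with
    | mem y hy =>
      obtain ⟨⟨r, hr⟩, hy⟩ := Set.mem_iUnion.1 hy
      refine Submodule.subset_span (Set.mem_iUnion.2 ⟨⟨r + deg g, ?_⟩, homog_mul_gen hy g⟩)
      have := neg_one_le_deg g
      push_cast at hr
      linarith
    | zero => rw [zero_mul]; exact Submodule.zero_mem _
    | add a b _ _ ha hb => rw [add_mul]; exact Submodule.add_mem _ ha hb
    | smul c a _ ha => rw [smul_eq_mul, mul_assoc]; exact Ideal.mul_mem_left _ _ ha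
  | hc c =>
    exact fun N => ⟨N, fun y hy => by rw [← Algebra.commutes]; exact Ideal.mul_mem_left _ _ hy⟩
  | ha a b ha hb =>
    intro N
    obtain ⟨M, hM⟩ := ha N
    obtain ⟨M', hM'⟩ := hb N
    refine ⟨max M M', fun y hy => ?_⟩
    rw [mul_add]
    exact Submodule.add_mem _ (hM _ (leftIdeal_antitone (le_max_left _ _) hy))
      (hM' _ (leftIdeal_antitone (le_max_right _ _) hy))
  | hm a b ha hb =>
    intro N
    obtain ⟨M, hM⟩ := hb N
    obtain ⟨M', hM'⟩ := ha M
    exact ⟨M', fun y hy => by rw [← mul_assoc]; exact hM _ (hM' _ hy)⟩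

theorem basis (n : ℕ) (ℏ ε : ℂ) :
    RingSubgroupsBasis fun N : ℕ => (leftIdeal n ℏ ε N).toAddSubgroup where
  inter i j := ⟨max i j, le_inf (leftIdeal_antitone (le_max_left _ _))
    (leftIdeal_antitone (le_max_right _ _))⟩
  mul i := ⟨i, by rintro _ ⟨a, -, b, hb, rfl⟩; exact Ideal.mul_mem_left _ _ hb⟩
  leftMul x i := ⟨i, fun _ hb => Ideal.mul_mem_left _ _ hb⟩
  rightMul x i := by
    obtain ⟨M, hM⟩ := leftIdeal_mul_right x i
    exact ⟨M, fun y hy => hM y hy⟩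

/-- The ring topology on the Yangian in which the left ideals `Y · ⋃_{r ≥ N} Y_r` form a basis
of neighbourhoods of `0`. -/
instance : TopologicalSpace (Yangian n ℏ ε) := (basis n ℏ ε).topology

instance : IsTopologicalRing (Yangian n ℏ ε) :=
  (basis n ℏ ε).toRingFilterBasis.isTopologicalRing

instance : UniformSpace (Yangian n ℏ ε) := IsTopologicalAddGroup.rightUniformSpace _

instance : IsUniformAddGroup (Yangian n ℏ ε) := isUniformAddGroup_of_addCommGroup

instance : UniformContinuousConstSMul ℂ (Yangian n ℏ ε) where
  uniformContinuous_const_smul c := by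
    have h : (fun x : Yangian n ℏ ε => c • x) = AddMonoidHom.mulLeft (algebraMap ℂ _ c) := by
      ext x; exact Algebra.smul_def c x
    rw [h]
    exact uniformContinuous_addMonoidHom_of_continuous (continuous_const_mul _)

/-- The (Hausdorff) completion `lim_N Y / (Y · ⋃_{r ≥ N} Y_r)`, a topological algebra. -/
abbrev FullCompletion (n : ℕ) (ℏ ε : ℂ) : Type := UniformSpace.Completion (Yangian n ℏ ε)

/-- The canonical map to the full completion. -/
def toFull : Yangian n ℏ ε →ₐ[ℂ] FullCompletion n ℏ ε :=
  { UniformSpace.Completion.coeRingHom with commutes' := fun _ => rfl }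

/-- The completed component of degree `d`: the closure of the image of `Y_d`, that is
`lim_N Y_d / ∑_{r ≥ N} Y_{d-r} Y_r`. -/
def homogCompl (n : ℕ) (ℏ ε : ℂ) (d : ℤ) : Submodule ℂ (FullCompletion n ℏ ε) where
  carrier := closure (toFull '' (homog n ℏ ε d : Set (Yangian n ℏ ε)))
  add_mem' {a b} ha hb := by
    refine map_mem_closure₂ continuous_add ha hb ?_
    rintro _ ⟨x, hx, rfl⟩ _ ⟨y, hy, rfl⟩
    exact ⟨x + y, Submodule.add_mem _ hx hy, map_add _ _ _⟩
  zero_mem' := subset_closure ⟨0, Submodule.zero_mem _, map_zero _⟩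
  smul_mem' c a ha := by
    refine map_mem_closure (continuous_const_smul c) ha ?_
    rintro _ ⟨x, hx, rfl⟩
    exact ⟨c • x, Submodule.smul_mem _ _ hx, map_smul _ _ _⟩

theorem homog_mul {d e : ℤ} {x y : Yangian n ℏ ε} (hx : x ∈ homog n ℏ ε d)
    (hy : y ∈ homog n ℏ ε e) : x * y ∈ homog n ℏ ε (d + e) := by
  induction hy using Submodule.span_induction with
  | mem y hy =>
    obtain ⟨l, hl, rfl⟩ := hy
    induction hx using Submodule.span_induction with
    | mem x hx =>
      obtain ⟨k, hk, rfl⟩ := hx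
      exact Submodule.subset_span ⟨k ++ l, by simp [hk, hl], by simp⟩
    | zero => rw [zero_mul]; exact Submodule.zero_mem _
    | add a b _ _ ha hb => rw [add_mul]; exact Submodule.add_mem _ ha hb
    | smul c a _ ha => rw [smul_mul_assoc]; exact Submodule.smul_mem _ _ ha
  | zero => rw [mul_zero]; exact Submodule.zero_mem _
  | add a b _ _ ha hb => rw [mul_add]; exact Submodule.add_mem _ ha hb
  | smul c a _ ha => rw [mul_smul_comm]; exact Submodule.smul_mem _ _ ha

theorem homogCompl_mul {d e : ℤ} {x y : FullCompletion n ℏ ε} (hx : x ∈ homogCompl n ℏ ε d)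
    (hy : y ∈ homogCompl n ℏ ε e) : x * y ∈ homogCompl n ℏ ε (d + e) := by
  refine map_mem_closure₂ continuous_mul hx hy ?_
  rintro _ ⟨x, hx, rfl⟩ _ ⟨y, hy, rfl⟩
  exact ⟨x * y, homog_mul hx hy, map_mul _ _ _⟩

theorem toFull_mem (x : Yangian n ℏ ε) : toFull x ∈ ⨆ d, homogCompl n ℏ ε d := by
  have key : ∀ y ∈ Submodule.span ℂ {y : Yangian n ℏ ε | ∃ l : List (Gen n), (l.map gen).prod = y},
      toFull y ∈ ⨆ d, homogCompl n ℏ ε d := by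
    intro y hy
    induction hy using Submodule.span_induction with
    | mem y hy =>
      obtain ⟨l, rfl⟩ := hy
      exact Submodule.mem_iSup_of_mem (l.map deg).sum
        (subset_closure ⟨_, Submodule.subset_span ⟨l, rfl, rfl⟩, rfl⟩)
    | zero => rw [map_zero]; exact Submodule.zero_mem _
    | add a b _ _ ha hb => rw [map_add]; exact Submodule.add_mem _ ha hb
    | smul c a _ ha => rw [map_smul]; exact Submodule.smul_mem _ _ ha
  refine key x ?_
  induction x using gen_induction with
  | hg g => exact Submodule.subset_span ⟨[g], by simp⟩
  | hc c =>
    rw [Algebra.algebraMap_eq_smul_one]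
    exact Submodule.smul_mem _ _ (Submodule.subset_span ⟨[], by simp⟩)
  | ha a b ha hb => exact Submodule.add_mem _ ha hb
  | hm a b ha hb =>
    refine Submodule.span_induction₂ (p := fun a b _ _ => a * b ∈ Submodule.span ℂ _)
      ?_ ?_ ?_ ?_ ?_ ?_ ?_ ha hb
    · rintro _ _ ⟨k, rfl⟩ ⟨l, rfl⟩
      exact Submodule.subset_span ⟨k ++ l, by simp⟩
    · intro b _; rw [zero_mul]; exact Submodule.zero_mem _
    · intro a _; rw [mul_zero]; exact Submodule.zero_mem _
    · intro a b c _ _ _ h1 h2; rw [add_mul]; exact Submodule.add_mem _ h1 h2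
    · intro a b c _ _ _ h1 h2; rw [mul_add]; exact Submodule.add_mem _ h1 h2
    · intro r a b _ _ h; rw [smul_mul_assoc]; exact Submodule.smul_mem _ _ h
    · intro r a b _ _ h; rw [mul_smul_comm]; exact Submodule.smul_mem _ _ h

/-- The degreewise completion `Ỹ_{ℏ,ε}(ŝl(n)) = ⨁_d lim_N Y_d / ∑_{r ≥ N} Y_{d-r} Y_r`, realized
inside the full completion as the sum of the completed homogeneous components. -/
def CompletedYangian (n : ℕ) (ℏ ε : ℂ) : Subalgebra ℂ (FullCompletion n ℏ ε) where
  carrier := ((⨆ d, homogCompl n ℏ ε d : Submodule ℂ (FullCompletion n ℏ ε)) : Set _)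
  add_mem' ha hb := Submodule.add_mem _ ha hb
  mul_mem' {a b} ha hb := by
    refine Submodule.iSup_induction _
      (motive := fun a => a * b ∈ ⨆ d, homogCompl n ℏ ε d) ha ?_ ?_ ?_
    · intro d x hx
      refine Submodule.iSup_induction _
        (motive := fun b => x * b ∈ ⨆ d, homogCompl n ℏ ε d) hb ?_ ?_ ?_
      · intro e y hy
        exact Submodule.mem_iSup_of_mem (d + e) (homogCompl_mul hx hy)
      · rw [mul_zero]; exact Submodule.zero_mem _
      · intro y z h1 h2; rw [mul_add]; exact Submodule.add_mem _ h1 h2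
    · rw [zero_mul]; exact Submodule.zero_mem _
    · intro y z h1 h2; rw [add_mul]; exact Submodule.add_mem _ h1 h2
  algebraMap_mem' r := by
    rw [← AlgHom.commutes (toFull (n := n) (ℏ := ℏ) (ε := ε)) r]
    exact toFull_mem _

/-- The canonical algebra homomorphism from the Yangian to its degreewise completion. -/
def toCompl : Yangian n ℏ ε →ₐ[ℂ] CompletedYangian n ℏ ε :=
  (toFull (n := n) (ℏ := ℏ) (ε := ε)).codRestrict _ toFull_mem

/-! ### Elements of the degreewise completion -/

/-- `X^±_{i,r}` in the completion. -/
def cX (σ : ℤˣ) (i : ZMod n) (r : Fin 2) : CompletedYangian n ℏ ε := toCompl (X σ i r)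

/-- `H_{i,r}` in the completion. -/
def cH (i : ZMod n) (r : Fin 2) : CompletedYangian n ℏ ε := toCompl (H i r)

/-- `H̃_{i,1}` in the completion. -/
def cHt (i : ZMod n) : CompletedYangian n ℏ ε := toCompl (Ht i)

/-- `E_{i,j} t^s` in the completion. -/
def cE (i j : ℕ) (s : ℤ) : CompletedYangian n ℏ ε := toCompl (E i j s)

/-- `Ψ` is the algebra homomorphism from `Y_{ℏ,ε}(ŝl(n))` to the degreewise completion of
`Y_{ℏ,ε}(ŝl(n+1))` determined by its values on the generators `H_{i,0}`, `X^±_{i,0}` for all nodes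
`i`, and `H_{i,1}`, `X^±_{i,1}` for the nodes `i ≠ 0`. -/
structure IsPsi (n : ℕ) (ℏ ε : ℂ) (Ψ : Yangian n ℏ ε →ₐ[ℂ] CompletedYangian (n + 1) ℏ ε) :
    Prop where
  H_zero_zero : Ψ (H 0 0) = cH 0 0 + cH (n : ZMod (n + 1)) 0
  Xp_zero_zero : Ψ (X 1 0 0) = cE n 1 1
  Xm_zero_zero : Ψ (X (-1) 0 0) = cE 1 n (-1)
  H_zero : ∀ i : ℕ, 1 ≤ i → i < n → Ψ (H (i : ZMod n) 0) = cH (i : ZMod (n + 1)) 0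
  Xp_zero : ∀ i : ℕ, 1 ≤ i → i < n → Ψ (X 1 (i : ZMod n) 0) = cE i (i + 1) 0
  Xm_zero : ∀ i : ℕ, 1 ≤ i → i < n → Ψ (X (-1) (i : ZMod n) 0) = cE (i + 1) i 0
  H_one : ∀ i : ℕ, 1 ≤ i → i < n →
    Ψ (H (i : ZMod n) 1) = cH (i : ZMod (n + 1)) 1
      - ℏ • ∑' s : ℕ, cE i (n + 1) (-(s : ℤ) - 1) * cE (n + 1) i ((s : ℤ) + 1)
      + ℏ • ∑' s : ℕ, cE (i + 1) (n + 1) (-(s : ℤ) - 1) * cE (n + 1) (i + 1) ((s : ℤ) + 1)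
  Xp_one : ∀ i : ℕ, 1 ≤ i → i < n →
    Ψ (X 1 (i : ZMod n) 1) = cX 1 (i : ZMod (n + 1)) 1
      - ℏ • ∑' s : ℕ, cE i (n + 1) (-(s : ℤ) - 1) * cE (n + 1) (i + 1) ((s : ℤ) + 1)
  Xm_one : ∀ i : ℕ, 1 ≤ i → i < n →
    Ψ (X (-1) (i : ZMod n) 1) = cX (-1) (i : ZMod (n + 1)) 1
      - ℏ • ∑' s : ℕ, cE (i + 1) (n + 1) (-(s : ℤ) - 1) * cE (n + 1) i ((s : ℤ) + 1)

theorem mk_rel {a b : FreeAlgebra ℂ (Gen n)} (h : Relation n ℏ ε a b) :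
    (mk a : Yangian n ℏ ε) = mk b :=
  RingQuot.mkAlgHom_rel ℂ h

theorem X_zero_one (hn : 3 ≤ n) (σ : ℤˣ) :
    (X σ 0 1 : Yangian n ℏ ε) = -(sgn σ • ((H 1 1 - (ℏ / 2) • H 1 0 ^ 2) * X σ 0 0
      - X σ 0 0 * (H 1 1 - (ℏ / 2) • H 1 0 ^ 2))) := by
  have : Fact (1 < n) := ⟨by omega⟩
  have h1 : (1 : ZMod n) ≠ 0 := one_ne_zero
  have h2 : (1 : ZMod n) ≠ -1 := by
    intro h
    have h3 : ((2 : ℕ) : ZMod n) = 0 := by push_cast; linear_combination h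
    rw [ZMod.natCast_eq_zero_iff] at h3
    exact absurd (Nat.le_of_dvd (by norm_num) h3) (by omega)
  have h := mk_rel (Relation.HtX (n := n) (ℏ := ℏ) (ε := ε) σ 1 0 (by simp) (by simp [h2]))
  have hs : sgn σ * sgn σ = 1 := by
    rcases Int.units_eq_one_or σ with rfl | rfl <;> simp [sgn]
  have hc : cartan n 1 0 = -1 := by simp [cartan]
  rw [hc, Ring.lie_def, map_sub, map_mul, map_mul, map_smul] at h
  have h4 : (mk (fHt ℏ 1) : Yangian n ℏ ε) = H 1 1 - (ℏ / 2) • H 1 0 ^ 2 := by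
    rw [fHt, map_sub, map_smul, map_pow]; rfl
  rw [h4] at h
  change (H 1 1 - (ℏ / 2) • H 1 0 ^ 2) * X σ 0 0 - X σ 0 0 * (H 1 1 - (ℏ / 2) • H 1 0 ^ 2)
    = _ • (X σ 0 1 : Yangian n ℏ ε) at h
  rw [h, smul_smul]
  push_cast
  rw [← mul_assoc, hs]
  simp

theorem H_zero_one : (H 0 1 : Yangian n ℏ ε) = X 1 0 1 * X (-1) 0 0 - X (-1) 0 0 * X 1 0 1 := by
  have h := mk_rel (Relation.XX10 (n := n) (ℏ := ℏ) (ε := ε) 0 0)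
  rw [if_pos rfl, Ring.lie_def, map_sub, map_mul, map_mul] at h
  exact h.symm

/-- The prescribed values determine `Ψ`. -/
theorem IsPsi.unique (hn : 3 ≤ n) {Ψ Ψ' : Yangian n ℏ ε →ₐ[ℂ] CompletedYangian (n + 1) ℏ ε}
    (h : IsPsi n ℏ ε Ψ) (h' : IsPsi n ℏ ε Ψ') : Ψ = Ψ' := by
  have : NeZero n := ⟨by omega⟩
  have hi : ∀ i : ZMod n, i ≠ 0 → ∃ k : ℕ, 1 ≤ k ∧ k < n ∧ (k : ZMod n) = i := fun i hi =>
    ⟨i.val, Nat.one_le_iff_ne_zero.2 (by simpa using hi), i.val_lt, by simp⟩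
  have hX0 : ∀ (σ : ℤˣ) (i : ZMod n), Ψ (X σ i 0) = Ψ' (X σ i 0) := by
    intro σ i
    by_cases h0 : i = 0
    · subst h0
      rcases Int.units_eq_one_or σ with rfl | rfl
      · rw [h.Xp_zero_zero, h'.Xp_zero_zero]
      · rw [h.Xm_zero_zero, h'.Xm_zero_zero]
    · obtain ⟨k, hk, hk', rfl⟩ := hi i h0
      rcases Int.units_eq_one_or σ with rfl | rfl
      · rw [h.Xp_zero k hk hk', h'.Xp_zero k hk hk']
      · rw [h.Xm_zero k hk hk', h'.Xm_zero k hk hk']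
  have hH1 : ∀ r, Ψ (H 1 r) = Ψ' (H 1 r) := by
    intro r
    have a := h.H_zero 1 le_rfl (by omega)
    have b := h.H_one 1 le_rfl (by omega)
    rw [← h'.H_zero 1 le_rfl (by omega)] at a
    rw [← h'.H_one 1 le_rfl (by omega)] at b
    fin_cases r
    · simpa using a
    · simpa using b
  have hX01 : ∀ σ, Ψ (X σ 0 1) = Ψ' (X σ 0 1) := by
    intro σ
    rw [X_zero_one hn]
    simp only [map_neg, map_smul, map_sub, map_mul, map_pow, hH1, hX0]
  ext x
  congr 1
  induction x using gen_induction with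
  | hg g =>
    cases g with
    | X σ i r =>
      change Ψ (X σ i r) = Ψ' (X σ i r)
      fin_cases r
      · exact hX0 σ i
      · by_cases h0 : i = 0
        · subst h0; exact hX01 σ
        · obtain ⟨k, hk, hk', rfl⟩ := hi i h0
          rcases Int.units_eq_one_or σ with rfl | rfl
          · exact (h.Xp_one k hk hk').trans (h'.Xp_one k hk hk').symm
          · exact (h.Xm_one k hk hk').trans (h'.Xm_one k hk hk').symm
    | H i r =>
      change Ψ (H i r) = Ψ' (H i r)
      by_cases h0 : i = 0
      · subst h0
        fin_cases r
        · exact h.H_zero_zero.trans h'.H_zero_zero.symm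
        · change Ψ (H 0 1) = Ψ' (H 0 1)
          rw [H_zero_one]
          simp only [map_sub, map_mul, hX01, hX0]
      · obtain ⟨k, hk, hk', rfl⟩ := hi i h0
        fin_cases r
        · exact (h.H_zero k hk hk').trans (h'.H_zero k hk hk').symm
        · exact (h.H_one k hk hk').trans (h'.H_one k hk hk').symm
  | hc c => rw [AlgHom.commutes, AlgHom.commutes]
  | ha a b ha hb => rw [map_add, map_add, ha, hb]
  | hm a b ha hb => rw [map_mul, map_mul, ha, hb]

end

end AffineYangian

/-!
In `Y(n)` the relation `[H̃_{1,1}, X^±_{0,0}] = ∓ X^±_{0,1}` expresses `X^±_{0,1}`, and then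
`H_{0,1} = [X⁺_{0,1}, X⁻_{0,0}]`, through elements on which `Ψ` is prescribed. So the values of `Ψ` are
commutators in the completion of `Y(n+1)`: of `Ψ(H̃_{1,1})`, which is `H̃_{1,1}` plus two series in the
root vectors, with `E_{n,1} t = [X⁺_{n,0}, X⁺_{0,0}]` or `E_{1,n} t⁻¹ = [X⁻_{0,0}, X⁻_{n,0}]`. The part
without series uses the defining relations only; the shift `(ε + (n+1)/2 ℏ)` in the relation of the
nodes `0` and `n` turns into `(ε + n/2 ℏ)` because `X⁻_{n,0} X⁺_{n,0}` is reordered. The brackets with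
the series are taken term by term (`hasSum_lie_right`).

The terms require commutators of real root vectors of `ŝl(n+1)` of arbitrary height, in an algebra
where only the Chevalley–Serre relations are known and the root vectors are nested brackets. They
follow from the brackets of the Chevalley generators with the real root vectors (`RootRelations`,
`IsChevalley.rootRelations`), which are proved by induction on the height. The tool is
`eq_zero_of_lie_f_eq_zero`: since each `ad e_i` is locally nilpotent on the subalgebra generated by the
`e_j`, an element of it that is killed by `f_i` and has positive `h_i`-weight vanishes. This replaces
any case-by-case use of the Serre relations. The symmetry `IsChevalley.mirror` carries the results to
negative roots.

Convergence (`summable_mul_toCompl`) holds since `E_{i,j} t^s` has degree `s`: the right factors of the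
products have degrees tending to infinity, so the partial sums are Cauchy, and as all terms have the
same degree the limit stays in one completed homogeneous component.
-/

namespace AffineYangian

/-! ### Weight vectors killed by a lowering operator -/

section Lie

variable {L : Type*} [LieRing L] [LieAlgebra ℂ L]

/-- In an `𝔰𝔩₂`-module on which `e` is locally nilpotent, a vector of positive weight that is killed
by `f` vanishes. -/
theorem eq_zero_of_lie_f_eq_zero {e f h v : L} (hef : ⁅e, f⁆ = h) (hhe : ⁅h, e⁆ = (2 : ℂ) • e)
    (hhf : ⁅h, f⁆ = -((2 : ℂ) • f)) (hv : v ∈ LieSubalgebra.engel ℂ e) (hfv : ⁅f, v⁆ = 0)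
    {r : ℕ} (hr : 0 < r) (hhv : ⁅h, v⁆ = (r : ℂ) • v) : v = 0 := by
  by_contra hv0
  have hr0 : (r : ℂ) ≠ 0 := by exact_mod_cast hr.ne'
  have hh : h ≠ 0 := by
    rintro rfl
    rw [zero_lie] at hhv
    exact (smul_ne_zero hr0 hv0) hhv.symm
  have t : IsSl2Triple (-h) f e :=
    { h_ne_zero := neg_ne_zero.2 hh
      lie_e_f := by rw [← hef, lie_skew]
      lie_h_e_nsmul := by rw [neg_lie, hhf, neg_neg, two_smul, two_nsmul]
      lie_h_f_nsmul := by rw [neg_lie, hhe, two_smul, two_nsmul] }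
  have P : t.HasPrimitiveVectorWith v (-(r : ℂ)) :=
    { ne_zero := hv0, lie_h := by rw [neg_lie, hhv, neg_smul], lie_e := hfv }
  obtain ⟨N, hN⟩ := (LieSubalgebra.mem_engel_iff ℂ e v).1 hv
  induction N with
  | zero => exact hv0 (by simpa using hN)
  | succ N ih =>
    refine ih ?_
    have h1 := P.lie_e_pow_succ_toEnd_f N
    have h2 : ((LieModule.toEnd ℂ L L e) ^ (N + 1)) v = 0 := hN
    rw [h2, lie_zero] at h1
    have h3 : (((N : ℂ) + 1) * (-(r : ℂ) - N)) ≠ 0 := by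
      have h4 : (((N + 1) * (r + N) : ℕ) : ℂ) ≠ 0 := by
        exact_mod_cast (Nat.mul_pos N.succ_pos (by omega)).ne'
      push_cast at h4
      intro h5
      exact h4 (by linear_combination -h5)
    exact (smul_eq_zero.1 h1.symm).resolve_left h3

end Lie

/-! ### Chevalley generators of affine type A -/

section Chevalley

variable {m : ℕ} {L : Type*} [LieRing L] [LieAlgebra ℂ L]

/-- Elements of a Lie algebra that satisfy the Chevalley–Serre relations of type `A_{m-1}^{(1)}`,
without the commutativity of the `h i`. -/
structure IsChevalley (e f h : ZMod m → L) : Prop where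
  lie_e_f : ∀ i j, ⁅e i, f j⁆ = if i = j then h i else 0
  lie_h_e : ∀ i j, ⁅h i, e j⁆ = (cartan m i j : ℂ) • e j
  lie_h_f : ∀ i j, ⁅h i, f j⁆ = -((cartan m i j : ℂ) • f j)
  serre_e : ∀ i j, i ≠ j → (fun y => ⁅e i, y⁆)^[1 + (cartan m i j).natAbs] (e j) = 0
  serre_f : ∀ i j, i ≠ j → (fun y => ⁅f i, y⁆)^[1 + (cartan m i j).natAbs] (f j) = 0

/-- The nested bracket `[e_a, [e_{a+1}, […, e_{a+k}]]]`: the root vector `E_{a, a+k+1}` of the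
affine Lie algebra, in the periodic notation. It is real if `a + k + 1 ≠ a` in `ℤ/mℤ`, and it is
the imaginary root vector `(E_{a,a} - E_{a+1,a+1}) t^q` if `k + 1 = q m`. -/
def rootVec (e : ZMod m → L) (a : ZMod m) : ℕ → L
  | 0 => e a
  | k + 1 => ⁅e a, rootVec e (a + 1) k⁆

/-- The value of the coroot `h_c` on the root `ε_a - ε_b`. -/
def rootWeight (c a b : ZMod m) : ℤ :=
  (if c = a then 1 else 0) - (if c + 1 = a then 1 else 0) - (if c = b then 1 else 0)
    + (if c + 1 = b then 1 else 0)

/-- The brackets of the Chevalley generators with the root vectors `E_{a,b}` of height `k + 1`,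
where `a ≠ b` in `ℤ/mℤ`. Brackets that lead from a real to an imaginary root vector are included
only where the nested bracket gives them without a correction. -/
structure RootRelations (e f : ZMod m → L) (k : ℕ) : Prop where
  e_zero : ∀ {a b c : ZMod m}, a + k + 1 = b → b ≠ a → c + 1 ≠ a → c ≠ b → ⁅e c, rootVec e a k⁆ = 0
  e_right : ∀ {a b : ZMod m}, a + k + 1 = b → b ≠ a → b + 1 ≠ a →
    ⁅e b, rootVec e a k⁆ = -rootVec e a (k + 1)
  f_zero : ∀ {a b c : ZMod m}, a + k + 1 = b → b ≠ a → c ≠ a → c + 1 ≠ b → ⁅f c, rootVec e a k⁆ = 0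
  f_left : ∀ {a b : ZMod m} {j : ℕ}, k = j + 1 → a + k + 1 = b → b ≠ a → b ≠ a + 1 →
    ⁅f a, rootVec e a k⁆ = rootVec e (a + 1) j
  f_right : ∀ {a b c : ZMod m} {j : ℕ}, k = j + 1 → a + k + 1 = b → b ≠ a → c + 1 = b →
    ⁅f c, rootVec e a k⁆ = -rootVec e a j

omit [LieAlgebra ℂ L] in
theorem rootVec_succ (e : ZMod m → L) (a : ZMod m) (k : ℕ) :
    rootVec e a (k + 1) = ⁅e a, rootVec e (a + 1) k⁆ := rfl

variable {e f h : ZMod m → L}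

namespace IsChevalley

variable (T : IsChevalley e f h)
include T

theorem lie_f_e_ne {i j : ZMod m} (hij : i ≠ j) : ⁅f i, e j⁆ = 0 := by
  rw [← lie_skew, T.lie_e_f, if_neg hij.symm, neg_zero]

theorem lie_f_e_self (i : ZMod m) : ⁅f i, e i⁆ = -h i := by
  rw [← lie_skew, T.lie_e_f, if_pos rfl]

theorem lie_e_e {i j : ZMod m} (h1 : i + 1 ≠ j) (h2 : i ≠ j + 1) : ⁅e i, e j⁆ = 0 := by
  rcases eq_or_ne i j with rfl | hij
  · exact lie_self _
  · have := T.serre_e i j hij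
    rwa [cartan, if_neg hij, if_neg (by grind)] at this

theorem eq_zero_of_lie_f (c : ZMod m) {v : L} (hv : v ∈ LieSubalgebra.engel ℂ (e c)) (hfv : ⁅f c, v⁆ = 0)
    {r : ℕ} (hr : 0 < r) (hhv : ⁅h c, v⁆ = (r : ℂ) • v) : v = 0 := by
  refine eq_zero_of_lie_f_eq_zero (e := e c) (f := f c) (h := h c) ?_ ?_ ?_ hv hfv hr hhv
  · rw [T.lie_e_f, if_pos rfl]
  · rw [T.lie_h_e]; simp [cartan]
  · rw [T.lie_h_f]; simp [cartan]

theorem e_mem_engel (c j : ZMod m) : e j ∈ LieSubalgebra.engel ℂ (e c) := by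
  rcases eq_or_ne c j with rfl | hij
  · exact LieSubalgebra.self_mem_engel ℂ _
  · rw [LieSubalgebra.mem_engel_iff]
    exact ⟨_, by rw [Module.End.pow_apply]; exact T.serre_e c j hij⟩

theorem rootVec_mem_engel (c a : ZMod m) (k : ℕ) :
    rootVec e a k ∈ LieSubalgebra.engel ℂ (e c) := by
  induction k generalizing a with
  | zero => exact T.e_mem_engel c a
  | succ k ih => exact LieSubalgebra.lie_mem _ (T.e_mem_engel c a) (ih _)

omit T in
theorem cartan_add_rootWeight (h2 : (2 : ZMod m) ≠ 0) (c a b : ZMod m) :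
    cartan m c a + rootWeight c (a + 1) b = rootWeight c a b := by
  simp only [cartan, rootWeight]
  grind

/-- `E_{a,b}` is a weight vector. -/
theorem lie_h_rootVec (h2 : (2 : ZMod m) ≠ 0) (c : ZMod m)
    {a b : ZMod m} {k : ℕ} (hb : a + k + 1 = b) :
    ⁅h c, rootVec e a k⁆ = (rootWeight c a b : ℂ) • rootVec e a k := by
  induction k generalizing a with
  | zero =>
    subst hb
    rw [rootVec, T.lie_h_e, ← cartan_add_rootWeight h2]
    simp [rootWeight]
  | succ k ih =>
    rw [rootVec, leibniz_lie, T.lie_h_e, ih (by rw [← hb]; push_cast; ring), smul_lie, lie_smul,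
      ← add_smul, ← cartan_add_rootWeight h2 c a b]
    push_cast; rfl

end IsChevalley

end Chevalley

/-! ### Brackets of the Chevalley generators with the root vectors -/

section GeneratorBrackets

variable {m : ℕ} {L : Type*} [LieRing L] [LieAlgebra ℂ L] {e f h : ZMod m → L}

namespace IsChevalley

variable (T : IsChevalley e f h)
include T

omit T in
theorem add_one_ne (h2 : (2 : ZMod m) ≠ 0) (a : ZMod m) : a + 1 ≠ a := fun h =>
  h2 (by linear_combination 2 * h)

omit T in
theorem add_one_add_one_ne (h2 : (2 : ZMod m) ≠ 0) (a : ZMod m) : a + 1 + 1 ≠ a := fun h =>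
  h2 (by linear_combination h)

theorem lie_h_rootVec_imaginary (h2 : (2 : ZMod m) ≠ 0) (c : ZMod m)
    {a : ZMod m} {k : ℕ} (hb : a + k + 1 = a) : ⁅h c, rootVec e a k⁆ = 0 := by
  rw [T.lie_h_rootVec h2 c hb]
  simp [rootWeight]

/-! The next theorems are the inductive step, on the height, in the proof of `rootRelations`. The
brackets with `f c` come straight from the nested form of the root vectors. For those with `e c` the
Serre relations are not expanded: both sides of a claimed identity have the same weight, this weight
is positive on a suitable coroot `h d`, and `f d` maps the difference of the two sides to `0` by what
is known for smaller heights, so `eq_zero_of_lie_f` applies. -/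

theorem f_zero_step (h2 : (2 : ZMod m) ≠ 0) {k : ℕ} (IH : ∀ j < k, RootRelations e f j)
    {a b c : ZMod m} (hb : a + k + 1 = b) (hba : b ≠ a) (hca : c ≠ a) (hcb : c + 1 ≠ b) :
    ⁅f c, rootVec e a k⁆ = 0 := by
  have h1a := add_one_ne h2 a
  obtain _ | j := k
  · exact T.lie_f_e_ne hca
  push_cast at hb
  rw [rootVec, leibniz_lie, T.lie_f_e_ne hca, zero_lie, zero_add]
  by_cases hb1 : b = a + 1
  -- Here `rootVec e (a + 1) j` is imaginary, and one more factor has to be split off.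
  · obtain _ | i := j
    · simp at hb
      exact absurd (by linear_combination hb + hb1) h1a
    push_cast at hb
    rw [rootVec, leibniz_lie (f c)]
    have hE : ⁅e a, rootVec e (a + 1 + 1) i⁆ = 0 :=
      (IH i (by omega)).e_zero (b := b) (by grind) (by grind) (by grind) (by grind)
    by_cases hc1 : c = a + 1
    · subst hc1
      rw [T.lie_f_e_self, (IH i (by omega)).f_zero (b := b) (by grind) (by grind) (by grind)
        (by grind), neg_lie, T.lie_h_rootVec h2 (b := b) _ (by grind), lie_zero, add_zero,
        lie_neg, lie_smul, hE, smul_zero, neg_zero]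
    rw [T.lie_f_e_ne hc1, zero_lie, zero_add]
    by_cases hc2 : c = a + 1 + 1
    · obtain _ | l := i
      · simp at hb; grind
      push_cast at hb
      rw [hc2, (IH (l + 1) (by omega)).f_left (b := b) rfl (by push_cast; grind) (by grind)
        (by grind), ← hb1, (IH l (by omega)).e_right (by grind) (by grind) (by grind), lie_neg,
        (IH (l + 1) (by omega)).e_zero (b := b + 1) (by push_cast; grind) (by grind) (by grind)
        (by grind), neg_zero]
    · rw [(IH i (by omega)).f_zero (b := b) (by grind) (by grind) hc2 hcb, lie_zero, lie_zero]
  · by_cases hc1 : c = a + 1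
    · obtain _ | i := j
      · simp at hb; grind
      push_cast at hb
      rw [hc1, (IH (i + 1) (by omega)).f_left (b := b) rfl (by push_cast; grind) (by grind)
        (by grind), (IH i (by omega)).e_zero (b := b) (by grind) (by grind) (by grind) (by grind)]
    · rw [(IH j (by omega)).f_zero (b := b) (by grind) (by grind) (by grind) (by grind), lie_zero]

theorem f_left_step (h2 : (2 : ZMod m) ≠ 0) {j : ℕ} (IH : ∀ i < j + 1, RootRelations e f i)
    {a b : ZMod m} (hb : a + (j + 1 : ℕ) + 1 = b) (hba : b ≠ a) (hba1 : b ≠ a + 1) :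
    ⁅f a, rootVec e a (j + 1)⁆ = rootVec e (a + 1) j := by
  have h2a := add_one_add_one_ne h2 a
  push_cast at hb
  have hw : rootWeight a (a + 1) b = -1 := by simp only [rootWeight]; grind
  rw [rootVec, leibniz_lie, T.lie_f_e_self, neg_lie, T.lie_h_rootVec h2 (b := b) _ (by grind),
    (IH j (by omega)).f_zero (b := b) (by grind) (by grind) (by grind) (by grind), hw]
  simp

theorem f_right_step (h2 : (2 : ZMod m) ≠ 0) {j : ℕ} (IH : ∀ i < j + 1, RootRelations e f i)
    {a b c : ZMod m} (hb : a + (j + 1 : ℕ) + 1 = b) (hba : b ≠ a) (hcb : c + 1 = b) :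
    ⁅f c, rootVec e a (j + 1)⁆ = -rootVec e a j := by
  push_cast at hb
  by_cases hca : c = a
  · rw [rootVec, leibniz_lie, hca, T.lie_f_e_self, neg_lie,
      T.lie_h_rootVec_imaginary h2 _ (by grind), neg_zero, zero_add]
    obtain _ | i := j
    · simp at hb; grind
    push_cast at hb
    obtain _ | l := i
    · simp at hb; grind
    push_cast at hb
    rw [rootVec, leibniz_lie (f a), T.lie_f_e_ne (by grind), zero_lie, zero_add,
      (IH (l + 1) (by omega)).f_right (b := b) rfl (by push_cast; grind) (by grind) (by grind),
      lie_neg, lie_neg, rootVec, rootVec]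
  · obtain _ | i := j
    · rw [zero_add, rootVec, rootVec, leibniz_lie, T.lie_f_e_ne hca, zero_lie, zero_add]
      simp at hb
      have hw : cartan m (a + 1) a = -1 := by simp only [cartan]; grind
      rw [show c = a + 1 by grind, rootVec, T.lie_f_e_self, lie_neg, lie_skew, T.lie_h_e, hw]
      simp
    · push_cast at hb
      rw [rootVec, leibniz_lie, T.lie_f_e_ne hca, zero_lie, zero_add,
        (IH (i + 1) (by omega)).f_right (b := b) rfl (by push_cast; grind) (by grind) hcb,
        lie_neg, rootVec]

/-- `[E_{a,a+1}, (E_{a,a} - E_{a+1,a+1}) t^q] = -2 E_{a,a+1} t^q`. -/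
theorem lie_e_rootVec_imaginary (h2 : (2 : ZMod m) ≠ 0) {j : ℕ}
    (IH : ∀ i < j + 1, RootRelations e f i) {a : ZMod m} (ha : a + j + 1 = a) :
    ⁅e a, rootVec e a j⁆ = -((2 : ℂ) • rootVec e a (j + 1)) := by
  have h1a := add_one_ne h2 a
  have h2a := add_one_add_one_ne h2 a
  rw [eq_neg_iff_add_eq_zero, rootVec, ← lie_smul, ← lie_add]
  refine T.eq_zero_of_lie_f a (LieSubalgebra.lie_mem _ (T.e_mem_engel a a) (add_mem
    (T.rootVec_mem_engel a a j) (LieSubalgebra.smul_mem _ _ (T.rootVec_mem_engel a _ j)))) ?_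
    two_pos ?_
  · obtain _ | i := j
    · exact absurd (by simpa using ha) h1a
    push_cast at ha
    obtain _ | l := i
    · simp at ha; grind
    push_cast at ha
    have hw : rootWeight a (a + 1) a = -2 := by simp only [rootWeight]; grind
    have key : ⁅f a, rootVec e a (l + 1 + 1) + (2 : ℂ) • rootVec e (a + 1) (l + 1 + 1)⁆ = 0 := by
      rw [lie_add, lie_smul, rootVec_succ e a, rootVec_succ e (a + 1) (l + 1), leibniz_lie,
        leibniz_lie _ (e (a + 1)), T.lie_f_e_self, T.lie_f_e_ne (by grind), neg_lie,
        T.lie_h_rootVec h2 (b := a) _ (by push_cast; grind), hw,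
        (IH (l + 1) (by omega)).f_zero (b := a) (by push_cast; grind) (by grind) (by grind)
          (by grind),
        (IH (l + 1) (by omega)).f_right (b := a + 1) rfl (by push_cast; grind) (by grind) rfl,
        lie_neg, ← rootVec_succ]
      simp
    rw [leibniz_lie, key, T.lie_f_e_self, neg_lie, lie_add, lie_smul,
      T.lie_h_rootVec_imaginary h2 _ (by push_cast; exact ha),
      T.lie_h_rootVec_imaginary h2 _ (by push_cast; grind)]
    simp
  · rw [leibniz_lie, T.lie_h_e, lie_add (h a), lie_smul (2 : ℂ) (h a),
      T.lie_h_rootVec_imaginary h2 _ ha, T.lie_h_rootVec_imaginary h2 _ (by grind)]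
    simp [cartan]

/-- The vector `[e_c, E_{a,b}]` has weight at least `2` on the coroot `h_c`. -/
theorem e_zero_step (h2 : (2 : ZMod m) ≠ 0) {k : ℕ} (IH : ∀ j < k, RootRelations e f j)
    {a b c : ZMod m} (hb : a + k + 1 = b) (hba : b ≠ a) (hca : c + 1 ≠ a) (hcb : c ≠ b) :
    ⁅e c, rootVec e a k⁆ = 0 := by
  obtain _ | j := k
  · simp at hb
    exact T.lie_e_e hca (by grind)
  push_cast at hb
  have hw : ∃ r : ℕ, 0 < r ∧ 2 + rootWeight c a b = r ∧
      rootWeight c a b = (if c = a then 1 else 0) + (if c + 1 = b then 1 else 0) := by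
    refine ⟨2 + (if c = a then 1 else 0) + (if c + 1 = b then 1 else 0), by omega, ?_, ?_⟩ <;>
    · simp only [rootWeight]; grind
  obtain ⟨r, hr0, hr, hw⟩ := hw
  refine T.eq_zero_of_lie_f c (LieSubalgebra.lie_mem _ (T.e_mem_engel c c) (T.rootVec_mem_engel c _ _)) ?_
    hr0 ?_
  · rw [leibniz_lie, T.lie_f_e_self, neg_lie, T.lie_h_rootVec h2 (b := b) _ (by push_cast; grind),
      hw]
    by_cases h3 : c = a
    · subst h3
      by_cases h4 : c + 1 = b
      · rw [T.f_right_step h2 IH (b := b) (by push_cast; grind) hba h4, lie_neg,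
          T.lie_e_rootVec_imaginary h2 IH (by grind), if_pos rfl, if_pos h4]
        push_cast
        rw [neg_neg, neg_add_cancel]
      · rw [T.f_left_step h2 IH (b := b) (by push_cast; grind) hba (by grind), ← rootVec_succ,
          if_pos rfl, if_neg h4]
        simp
    · by_cases h4 : c + 1 = b
      · rw [T.f_right_step h2 IH (b := b) (by push_cast; grind) hba h4, lie_neg,
          (IH j (by omega)).e_right (by grind) (by grind) (by grind), if_neg h3, if_pos h4]
        simp
      · rw [T.f_zero_step h2 IH (b := b) (by push_cast; grind) hba h3 h4, if_neg h3, if_neg h4]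
        simp
  · have : (r : ℂ) = 2 + (rootWeight c a b : ℂ) := by exact_mod_cast hr.symm
    rw [leibniz_lie, T.lie_h_e, T.lie_h_rootVec h2 (b := b) _ (by push_cast; grind), smul_lie,
      lie_smul, ← add_smul, this]
    simp [cartan]

/-- `[E_{a+1,a+2}, (E_{a,a} - E_{a+1,a+1}) t^q] = E_{a+1,a+2} t^q`. -/
theorem lie_e_succ_rootVec_imaginary (h2 : (2 : ZMod m) ≠ 0) {j : ℕ}
    (IH : ∀ i < j + 1, RootRelations e f i) {a : ZMod m} (ha : a + j + 1 = a) :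
    ⁅e (a + 1), rootVec e a j⁆ = rootVec e (a + 1) (j + 1) := by
  have h1a := add_one_ne h2 a
  have h2a := add_one_add_one_ne h2 a
  rw [← sub_eq_zero, rootVec, ← lie_sub]
  refine T.eq_zero_of_lie_f (a + 1) (LieSubalgebra.lie_mem _ (T.e_mem_engel _ _) (sub_mem
    (T.rootVec_mem_engel _ a j) (T.rootVec_mem_engel _ _ j))) ?_ two_pos ?_
  · obtain _ | i := j
    · exact absurd (by simpa using ha) h1a
    push_cast at ha
    obtain _ | l := i
    · simp at ha; grind
    push_cast at ha
    have key : ⁅f (a + 1), rootVec e a (l + 1 + 1) - rootVec e (a + 1 + 1) (l + 1 + 1)⁆ = 0 := by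
      rw [lie_sub, rootVec_succ e a, rootVec_succ e (a + 1 + 1) (l + 1), leibniz_lie,
        leibniz_lie _ (e (a + 1 + 1)), T.lie_f_e_ne (by grind), T.lie_f_e_ne (by grind),
        (IH (l + 1) (by omega)).f_left (b := a) rfl (by push_cast; grind) (by grind) (by grind),
        (IH (l + 1) (by omega)).f_right (b := a + 1 + 1) rfl (by push_cast; grind) (by grind) rfl,
        (IH l (by omega)).e_right (by grind) (by grind) (by grind), lie_neg, ← rootVec_succ]
      simp
    rw [leibniz_lie, key, T.lie_f_e_self, neg_lie, lie_sub,
      T.lie_h_rootVec_imaginary h2 _ (by push_cast; exact ha),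
      T.lie_h_rootVec_imaginary h2 _ (by push_cast; grind)]
    simp
  · rw [leibniz_lie, T.lie_h_e, lie_sub (h (a + 1)),
      T.lie_h_rootVec_imaginary h2 _ ha, T.lie_h_rootVec_imaginary h2 _ (by grind)]
    simp [cartan, smul_sub]

/-- The difference of the two sides has weight `1` on the coroot `h_a`. -/
theorem e_right_step (h2 : (2 : ZMod m) ≠ 0) {k : ℕ} (IH : ∀ j < k, RootRelations e f j)
    {a b : ZMod m} (hb : a + k + 1 = b) (hba : b ≠ a) (hb1 : b + 1 ≠ a) :
    ⁅e b, rootVec e a k⁆ = -rootVec e a (k + 1) := by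
  obtain _ | j := k
  · simp at hb
    rw [rootVec_succ, hb, rootVec, rootVec, lie_skew]
  rw [eq_neg_iff_add_eq_zero]
  push_cast at hb
  refine T.eq_zero_of_lie_f a (add_mem (LieSubalgebra.lie_mem _ (T.e_mem_engel a b)
    (T.rootVec_mem_engel a _ _)) (T.rootVec_mem_engel a _ _)) ?_ one_pos ?_
  · have hw : rootWeight a (a + 1) (b + 1) = -1 := by simp only [rootWeight]; grind
    rw [lie_add, leibniz_lie, T.lie_f_e_ne hba.symm, zero_lie, zero_add, rootVec_succ e a (j + 1),
      leibniz_lie _ (e a), T.lie_f_e_self, neg_lie,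
      T.lie_h_rootVec h2 (a := a + 1) (b := b + 1) _ (by push_cast; grind), hw,
      T.f_zero_step h2 IH (a := a + 1) (b := b + 1) (by push_cast; grind) (by grind) (by grind)
        (by grind)]
    by_cases h3 : b = a + 1
    · rw [T.f_right_step h2 IH (b := b) (by push_cast; grind) hba h3.symm, h3, lie_neg,
        T.lie_e_succ_rootVec_imaginary h2 IH (by grind)]
      simp
    · rw [T.f_left_step h2 IH (b := b) (by push_cast; grind) hba h3,
        (IH j (by omega)).e_right (by grind) (by grind) (by grind)]
      simp
  · have hw : cartan m a b + rootWeight a a b = 1 := by simp only [cartan, rootWeight]; grind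
    have hw' : rootWeight a a (b + 1) = 1 := by simp only [rootWeight]; grind
    have : (cartan m a b : ℂ) + (rootWeight a a b : ℂ) = 1 := by exact_mod_cast hw
    rw [lie_add, leibniz_lie, T.lie_h_e, T.lie_h_rootVec h2 (b := b) _ (by push_cast; grind),
      T.lie_h_rootVec h2 (b := b + 1) _ (by push_cast; grind), smul_lie,
      lie_smul, ← add_smul, this, hw', Nat.cast_one, Int.cast_one, smul_add]

/-- The brackets of the Chevalley generators with all real root vectors. -/
theorem rootRelations (h2 : (2 : ZMod m) ≠ 0) (k : ℕ) : RootRelations e f k := by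
  induction k using Nat.strong_induction_on with
  | _ k IH =>
    exact
      { e_zero := T.e_zero_step h2 IH
        e_right := T.e_right_step h2 IH
        f_zero := T.f_zero_step h2 IH
        f_left := by rintro a b j rfl; exact T.f_left_step h2 IH
        f_right := by rintro a b c j rfl; exact T.f_right_step h2 IH }

end IsChevalley

end GeneratorBrackets

/-! ### Brackets with root vectors of height two -/

section HeightTwo

variable {m : ℕ} {L : Type*} [LieRing L] [LieAlgebra ℂ L] {e f h : ZMod m → L}

namespace IsChevalley

/-- The diagram automorphism `i ↦ -i` composed with the exchange of `e` and `f`. It sends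
`E_{a,b}` to `E_{1-a,1-b}` and thereby exchanges positive and negative roots. -/
theorem mirror (T : IsChevalley e f h) :
    IsChevalley (fun i => f (-i)) (fun i => e (-i)) (fun i => -h (-i)) where
  lie_e_f i j := by
    rw [← lie_skew, T.lie_e_f]
    simp only [neg_inj, eq_comm (a := j)]
    split_ifs with hij
    · rw [hij]
    · rw [neg_zero]
  lie_h_e i j := by
    rw [neg_lie, T.lie_h_f, neg_neg]
    congr 2
    simp only [cartan]
    grind
  lie_h_f i j := by
    rw [neg_lie, T.lie_h_e]
    congr 3
    simp only [cartan]
    grind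
  serre_e i j hij := by
    rw [show cartan m i j = cartan m (-i) (-j) by simp only [cartan]; grind]
    exact T.serre_f _ _ (by grind)
  serre_f i j hij := by
    rw [show cartan m i j = cartan m (-i) (-j) by simp only [cartan]; grind]
    exact T.serre_e _ _ (by grind)

theorem ne_of_eq_add {R : Type*} [AddGroup R] {x y d : R} (hd : d ≠ 0) (h : x = y + d) : x ≠ y := by
  rw [h]
  simpa using hd

variable (T : IsChevalley e f h) (h2 : (2 : ZMod m) ≠ 0) (a : ZMod m)
  {k : ℕ} (hk : (k : ZMod m) = 0)
include T h2

/-- `[E_{a+1,a}, E_{a-1,a+1}] = -E_{a-1,a}`. -/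
theorem lie_f_lie_e_e : ⁅f a, ⁅e (a - 1), e a⁆⁆ = -e (a - 1) := by
  have h1 : (1 : ZMod m) ≠ 0 := fun h => h2 (by linear_combination 2 * h)
  have hc : cartan m a (a - 1) = -1 := by
    simp [cartan, ne_of_eq_add h1 (show a = a - 1 + 1 by ring)]
  rw [leibniz_lie, T.lie_f_e_ne (ne_of_eq_add h1 (by ring)), T.lie_f_e_self, lie_neg, lie_skew,
    T.lie_h_e, hc]
  simp

/-- `[E_{a,a+1}, E_{a+1,a-1}] = E_{a,a-1}`. -/
theorem lie_e_lie_f_f : ⁅e a, ⁅f a, f (a - 1)⁆⁆ = f (a - 1) := by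
  have h1 : (1 : ZMod m) ≠ 0 := fun h => h2 (by linear_combination 2 * h)
  have hc : cartan m a (a - 1) = -1 := by
    simp [cartan, ne_of_eq_add h1 (show a = a - 1 + 1 by ring)]
  rw [leibniz_lie, T.lie_e_f, T.lie_e_f, if_pos rfl, if_neg (ne_of_eq_add h1 (by ring)),
    T.lie_h_f, hc]
  simp

/-- `[E_{a-1,a}, E_{a+1,a-1}] = -E_{a+1,a}`. -/
theorem lie_e_pred_lie_f_f : ⁅e (a - 1), ⁅f a, f (a - 1)⁆⁆ = -f a := by
  have h1 : (1 : ZMod m) ≠ 0 := fun h => h2 (by linear_combination 2 * h)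
  have hc : cartan m (a - 1) a = -1 := by simp [cartan, h1]
  rw [leibniz_lie, T.lie_e_f, T.lie_e_f, if_pos rfl, if_neg (ne_of_eq_add h1 (by ring)).symm,
    ← lie_skew (f a), T.lie_h_f, hc]
  simp

/-! The loop exponent is `q` where `k = q m` below. -/

include hk

/-- `[E_{a,a+1} t^q, E_{a-1,a+1}] = 0`. -/
theorem lie_rootVec_lie_e_e :
    ⁅rootVec e a k, ⁅e (a - 1), e a⁆⁆ = 0 := by
  have R := T.rootRelations h2
  have h1 : (1 : ZMod m) ≠ 0 := fun h => h2 (by linear_combination 2 * h)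
  rw [← lie_skew, lie_lie, (R k).e_zero (b := a + 1) (by grind) (ne_of_eq_add h1 (by ring))
    (ne_of_eq_add h1 (by ring)) (ne_of_eq_add h1 (by ring)).symm,
    show rootVec e a k = rootVec e (a - 1 + 1) k by simp, ← rootVec_succ,
    (R (k + 1)).e_zero (b := a + 1) (by push_cast; grind) (ne_of_eq_add h2 (by ring))
      (ne_of_eq_add h2 (by ring)) (ne_of_eq_add h1 (by ring)).symm]
  simp

/-- `[E_{a,a+2} t^q, E_{a-1,a+1}] = 0`. -/
theorem lie_rootVec_succ_lie_e_e (h3 : (3 : ZMod m) ≠ 0) :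
    ⁅rootVec e a (k + 1), ⁅e (a - 1), e a⁆⁆ = 0 := by
  have R := T.rootRelations h2
  have h1 : (1 : ZMod m) ≠ 0 := fun h => h2 (by linear_combination 2 * h)
  rw [← lie_skew, lie_lie,
    (R (k + 1)).e_zero (b := a + 2) (by push_cast; grind) (ne_of_eq_add h2 (by ring))
      (ne_of_eq_add h1 (by ring)) (ne_of_eq_add h2 (by ring)).symm,
    show rootVec e a (k + 1) = rootVec e (a - 1 + 1) (k + 1) by simp, ← rootVec_succ,
    (R (k + 2)).e_zero (b := a + 2) (by push_cast; grind) (ne_of_eq_add h3 (by ring))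
      (ne_of_eq_add h2 (by ring)) (ne_of_eq_add h2 (by ring)).symm]
  simp

/-- `[E_{a,a+2} t^q, E_{a+1,a-1}] = 0`. -/
theorem lie_rootVec_succ_lie_f_f :
    ⁅rootVec e a (k + 1), ⁅f a, f (a - 1)⁆⁆ = 0 := by
  have R := T.rootRelations h2
  have h1 : (1 : ZMod m) ≠ 0 := fun h => h2 (by linear_combination 2 * h)
  rw [← lie_skew, lie_lie,
    (R (k + 1)).f_zero (c := a - 1) (b := a + 2) (by push_cast; grind) (ne_of_eq_add h2 (by ring))
      (ne_of_eq_add h1 (by ring)).symm (ne_of_eq_add h2 (by ring)).symm,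
    (R (k + 1)).f_left (b := a + 2) rfl (by push_cast; grind) (ne_of_eq_add h2 (by ring))
      (ne_of_eq_add h1 (by ring)),
    (R k).f_zero (b := a + 2) (by grind) (ne_of_eq_add h1 (by ring))
      (ne_of_eq_add h2 (by ring)).symm (ne_of_eq_add h2 (by ring)).symm]
  simp

/-- `[E_{a-1,a+1} t^q, E_{a+2,a}] = 0`. -/
theorem lie_rootVec_sub_one_lie_f_f :
    ⁅rootVec e (a - 1) (k + 1), ⁅f (a + 1), f a⁆⁆ = 0 := by
  have R := T.rootRelations h2
  have h1 : (1 : ZMod m) ≠ 0 := fun h => h2 (by linear_combination 2 * h)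
  rw [← lie_skew, lie_lie,
    (R (k + 1)).f_zero (c := a + 1) (b := a + 1) (by push_cast; grind) (ne_of_eq_add h2 (by ring))
      (ne_of_eq_add h2 (by ring)) (ne_of_eq_add h1 (by ring)),
    (R (k + 1)).f_right (b := a + 1) rfl (by push_cast; grind) (ne_of_eq_add h2 (by ring))
      (by grind), lie_neg,
    (R k).f_zero (b := a) (by grind) (ne_of_eq_add h1 (by ring)) (ne_of_eq_add h2 (by ring))
      (ne_of_eq_add h2 (by ring))]
  simp

/-- `[E_{a,a+1} t^q, E_{a,a+2}] = 0`. -/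
theorem lie_rootVec_lie_e_e' :
    ⁅rootVec e a k, ⁅e a, e (a + 1)⁆⁆ = 0 := by
  have R := T.rootRelations h2
  have h1 : (1 : ZMod m) ≠ 0 := fun h => h2 (by linear_combination 2 * h)
  rw [← lie_skew, lie_lie, (R k).e_zero (c := a) (b := a + 1) (by grind)
    (ne_of_eq_add h1 (by ring)) (ne_of_eq_add h1 (by ring)) (ne_of_eq_add h1 (by ring)).symm,
    (R k).e_right (b := a + 1) (by grind) (ne_of_eq_add h1 (by ring)) (ne_of_eq_add h2 (by ring)),
      lie_neg,
    (R (k + 1)).e_zero (b := a + 2) (by push_cast; grind) (ne_of_eq_add h2 (by ring))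
      (ne_of_eq_add h1 (by ring)) (ne_of_eq_add h2 (by ring)).symm]
  simp

/-- `[E_{a-1,a+1} t^q, E_{a,a+2}] = 0`. -/
theorem lie_rootVec_sub_one_lie_e_e (h3 : (3 : ZMod m) ≠ 0) :
    ⁅rootVec e (a - 1) (k + 1), ⁅e a, e (a + 1)⁆⁆ = 0 := by
  have R := T.rootRelations h2
  have h1 : (1 : ZMod m) ≠ 0 := fun h => h2 (by linear_combination 2 * h)
  rw [← lie_skew, lie_lie,
    (R (k + 1)).e_zero (c := a) (b := a + 1) (by push_cast; grind) (ne_of_eq_add h2 (by ring))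
      (ne_of_eq_add h2 (by ring)) (ne_of_eq_add h1 (by ring)).symm,
    (R (k + 1)).e_right (b := a + 1) (by push_cast; grind) (ne_of_eq_add h2 (by ring))
      (ne_of_eq_add h3 (by ring)), lie_neg,
    (R (k + 2)).e_zero (b := a + 2) (by push_cast; grind) (ne_of_eq_add h3 (by ring))
      (ne_of_eq_add h2 (by ring)) (ne_of_eq_add h2 (by ring)).symm]
  simp

omit hk
variable {j : ℕ} (hj : ((j + 2 : ℕ) : ZMod m) = 0)
include hj

/-- `[E_{a,a+1} t^q, E_{a+1,a-1}] = E_{a,a-1} t^q`, where `q ≥ 1`. -/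
theorem lie_rootVec_lie_f_f :
    ⁅rootVec e a (j + 2), ⁅f a, f (a - 1)⁆⁆ = rootVec e a j := by
  have R := T.rootRelations h2
  have h1 : (1 : ZMod m) ≠ 0 := fun h => h2 (by linear_combination 2 * h)
  push_cast at hj
  obtain _ | i := j
  · exact absurd (by simpa using hj) h2
  push_cast at hj
  rw [← lie_skew, lie_lie,
    (R (i + 1 + 2)).f_zero (b := a + 1) (by push_cast; grind) (by grind) (by grind) (by grind),
    (R (i + 1 + 2)).f_right (b := a + 1) rfl (by push_cast; grind) (by grind) (by grind), lie_neg,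
    rootVec_succ, leibniz_lie (f (a - 1)), T.lie_f_e_ne (by grind),
    (R (i + 1)).f_right (b := a) rfl (by push_cast; grind) (by grind) (by grind), rootVec_succ]
  simp [rootVec_succ]

/-- `[E_{a,a+1} t^q, E_{a+2,a}] = -E_{a+2,a+1} t^q`, where `q ≥ 1`. -/
theorem lie_rootVec_lie_f_f' :
    ⁅rootVec e a (j + 2), ⁅f (a + 1), f a⁆⁆ = -rootVec e (a + 2) j := by
  have R := T.rootRelations h2
  have h1 : (1 : ZMod m) ≠ 0 := fun h => h2 (by linear_combination 2 * h)
  push_cast at hj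
  obtain _ | i := j
  · exact absurd (by simpa using hj) h2
  push_cast at hj
  rw [← lie_skew, lie_lie,
    (R (i + 1 + 2)).f_zero (c := a + 1) (b := a + 1) (by push_cast; grind) (by grind) (by grind)
      (by grind),
    (R (i + 1 + 2)).f_right (b := a + 1) rfl (by push_cast; grind) (by grind) (by grind), lie_neg,
    rootVec_succ, leibniz_lie (f (a + 1)), T.lie_f_e_ne (by grind), zero_lie,
    zero_add,
    (R (i + 1)).f_left (b := a) rfl (by push_cast; grind) (by grind) (by grind),
    (R i).e_right (b := a) (by grind) (by grind) (by grind), add_assoc,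
      one_add_one_eq_two]
  simp

/-- `[E_{a+2,a+1} t^q, E_{a,a+2}] = -E_{a,a+1} t^q`, where `q ≥ 1`. -/
theorem lie_rootVec_add_two_lie_e_e :
    ⁅rootVec e (a + 2) j, ⁅e a, e (a + 1)⁆⁆ = -rootVec e a (j + 2) := by
  have R := T.rootRelations h2
  have h1 : (1 : ZMod m) ≠ 0 := fun h => h2 (by linear_combination 2 * h)
  push_cast at hj
  rw [← lie_skew, lie_lie,
    (R j).e_zero (c := a) (b := a + 1) (by grind) (ne_of_eq_add h1 (by ring)).symm
      (ne_of_eq_add h1 (by ring)).symm (ne_of_eq_add h1 (by ring)).symm,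
    show rootVec e (a + 2) j = rootVec e (a + 1 + 1) j by rw [add_assoc, one_add_one_eq_two],
      ← rootVec_succ,
    ← rootVec_succ]
  simp

end IsChevalley

end HeightTwo

/-! ### Root vectors in the Yangian -/

section YangianBrackets

attribute [local instance 100] LieRing.ofAssociativeRing

variable {n : ℕ} {ℏ ε : ℂ}

theorem mk_lie (a b : FreeAlgebra ℂ (Gen n)) :
    (mk ⁅a, b⁆ : Yangian n ℏ ε) = ⁅(mk a : Yangian n ℏ ε), (mk b : Yangian n ℏ ε)⁆ := by
  rw [Ring.lie_def, Ring.lie_def, map_sub, map_mul, map_mul]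

theorem mk_fHt (i : ZMod n) : (mk (fHt ℏ i) : Yangian n ℏ ε) = Ht i := by
  rw [fHt, map_sub, map_smul, map_pow]; rfl

theorem mk_iterate_lie (a b : FreeAlgebra ℂ (Gen n)) (k : ℕ) :
    (mk ((fun y => ⁅a, y⁆)^[k] b) : Yangian n ℏ ε)
      = (fun y => ⁅(mk a : Yangian n ℏ ε), y⁆)^[k] (mk b) := by
  induction k with
  | zero => rfl
  | succ k ih => rw [Function.iterate_succ_apply', Function.iterate_succ_apply', mk_lie, ih]

/-- The Chevalley–Serre relations of the level-zero generators. -/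
theorem isChevalley (n : ℕ) (ℏ ε : ℂ) :
    IsChevalley (fun i : ZMod n => (X 1 i 0 : Yangian n ℏ ε)) (fun i => X (-1) i 0)
      (fun i => H i 0) where
  lie_e_f i j := by
    have h := mk_rel (Relation.XX00 (n := n) (ℏ := ℏ) (ε := ε) i j)
    rw [mk_lie, apply_ite mk, map_zero] at h
    exact h
  lie_h_e i j := by
    have h := mk_rel (Relation.HX (n := n) (ℏ := ℏ) (ε := ε) 1 i j 0)
    rw [mk_lie, map_smul] at h
    change ⁅H i 0, X 1 j 0⁆ = _ • (X 1 j 0 : Yangian n ℏ ε) at h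
    rw [sgn] at h
    simpa using h
  lie_h_f i j := by
    have h := mk_rel (Relation.HX (n := n) (ℏ := ℏ) (ε := ε) (-1) i j 0)
    rw [mk_lie, map_smul] at h
    change ⁅H i 0, X (-1) j 0⁆ = _ • (X (-1) j 0 : Yangian n ℏ ε) at h
    rw [sgn] at h
    simpa using h
  serre_e i j hij := by
    have h := mk_rel (Relation.serre (n := n) (ℏ := ℏ) (ε := ε) 1 i j hij)
    rw [mk_iterate_lie, map_zero] at h
    exact h
  serre_f i j hij := by
    have h := mk_rel (Relation.serre (n := n) (ℏ := ℏ) (ε := ε) (-1) i j hij)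
    rw [mk_iterate_lie, map_zero] at h
    exact h

theorem posRoot_eq_rootVec (a : ZMod n) (k : ℕ) :
    (posRoot a k : Yangian n ℏ ε) = rootVec (fun i => X 1 i 0) a k := by
  induction k generalizing a with
  | zero => rfl
  | succ k ih => rw [posRoot, rootVec, ih]

/-- Negative root vectors are positive root vectors for the mirrored generators, see
`IsChevalley.mirror`. -/
theorem negRoot_eq_rootVec (a : ZMod n) (k : ℕ) :
    (negRoot a k : Yangian n ℏ ε) = rootVec (fun i => X (-1) (-i) 0) (-(a + (k : ZMod n))) k := by
  induction k with
  | zero => simp [negRoot, rootVec]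
  | succ k ih =>
    rw [negRoot, rootVec, ih, neg_neg]
    congr 2
    push_cast
    ring

theorem E_eq_posRoot {i j : ℕ} {s : ℤ} {k : ℕ} (h : (j : ℤ) + s * n = i + k + 1) :
    (E i j s : Yangian n ℏ ε) = rootVec (fun i => X 1 i 0) (i : ZMod n) k := by
  rw [E, if_pos (by omega), posRoot_eq_rootVec, show (j + s * n - i - 1 : ℤ).toNat = k by omega]

theorem E_eq_negRoot {i j : ℕ} {s : ℤ} {k : ℕ} (h : (j : ℤ) + s * n + k + 1 = i) :
    (E i j s : Yangian n ℏ ε) = rootVec (fun i => X (-1) (-i) 0) (1 - (i : ZMod n)) k := by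
  rw [E, if_neg (by omega), negRoot_eq_rootVec,
    show (i - (j + s * n) - 1 : ℤ).toNat = k by omega]
  congr 1
  have := congrArg (Int.cast : ℤ → ZMod n) h
  push_cast at this ⊢
  linear_combination -this

/-! In `Y(n+1)` the node `n` is `-1`. -/

theorem natCast_last (n : ℕ) : (n : ZMod (n + 1)) = -1 := by
  have : ((n + 1 : ℕ) : ZMod (n + 1)) = 0 := ZMod.natCast_self _
  push_cast at this
  linear_combination this

theorem two_ne_zero_zmod (hn : 3 ≤ n) : (2 : ZMod (n + 1)) ≠ 0 := by
  intro h
  have h3 : ((2 : ℕ) : ZMod (n + 1)) = 0 := by exact_mod_cast h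
  rw [ZMod.natCast_eq_zero_iff] at h3
  exact absurd (Nat.le_of_dvd (by norm_num) h3) (by omega)

theorem three_ne_zero_zmod (hn : 3 ≤ n) : (3 : ZMod (n + 1)) ≠ 0 := by
  intro h
  have h3 : ((3 : ℕ) : ZMod (n + 1)) = 0 := by exact_mod_cast h
  rw [ZMod.natCast_eq_zero_iff] at h3
  exact absurd (Nat.le_of_dvd (by norm_num) h3) (by omega)

theorem natCast_mul_last (n s : ℕ) : ((s * (n + 1) : ℕ) : ZMod (n + 1)) = 0 :=
  (ZMod.natCast_eq_zero_iff _ _).2 (dvd_mul_left _ _)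

/-- `E_{n+1,1} t^{s+1}`. -/
theorem E_last_one (s : ℕ) : (E (n + 1) 1 (s + 1) : Yangian (n + 1) ℏ ε)
    = rootVec (fun i => X 1 i 0) 0 (s * (n + 1)) := by
  rw [E_eq_posRoot (k := s * (n + 1)) (by push_cast; ring), ZMod.natCast_self]

/-- `E_{n+1,2} t^{s+1}`. -/
theorem E_last_two (s : ℕ) : (E (n + 1) 2 (s + 1) : Yangian (n + 1) ℏ ε)
    = rootVec (fun i => X 1 i 0) 0 (s * (n + 1) + 1) := by
  rw [E_eq_posRoot (k := s * (n + 1) + 1) (by push_cast; ring), ZMod.natCast_self]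

/-- `E_{1,n+1} t^{-s-1}`. -/
theorem E_one_last (s : ℕ) : (E 1 (n + 1) (-s - 1) : Yangian (n + 1) ℏ ε)
    = rootVec (fun i => X (-1) (-i) 0) 0 (s * (n + 1)) := by
  rw [E_eq_negRoot (k := s * (n + 1)) (by push_cast; ring), Nat.cast_one, sub_self]

/-- `E_{2,n+1} t^{-s-1}`. -/
theorem E_two_last (s : ℕ) : (E 2 (n + 1) (-s - 1) : Yangian (n + 1) ℏ ε)
    = rootVec (fun i => X (-1) (-i) 0) (0 - 1) (s * (n + 1) + 1) := by
  rw [E_eq_negRoot (k := s * (n + 1) + 1) (by push_cast; ring)]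
  congr 1
  push_cast
  ring

/-- `E_{n,n+1} t^{-s-1}`. -/
theorem E_pred_last {s k : ℕ} (hk : k + 2 = (s + 1) * (n + 1)) :
    (E n (n + 1) (-s - 1) : Yangian (n + 1) ℏ ε)
      = rootVec (fun i => X (-1) (-i) 0) (0 + 2) k := by
  rw [E_eq_negRoot (k := k) (by zify at hk; push_cast; linear_combination hk), natCast_last]
  congr 1
  ring

/-- `E_{n+1,n} t^{s+1}`. -/
theorem E_last_pred {s k : ℕ} (hk : k + 2 = (s + 1) * (n + 1)) :
    (E (n + 1) n (s + 1) : Yangian (n + 1) ℏ ε) = rootVec (fun i => X 1 i 0) 0 k := by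
  rw [E_eq_posRoot (k := k) (by zify at hk; push_cast; linear_combination -hk), ZMod.natCast_self]

theorem E_pred_last_zero : (E n (n + 1) 0 : Yangian (n + 1) ℏ ε) = X 1 (n : ZMod (n + 1)) 0 := by
  rw [E_eq_posRoot (k := 0) (by push_cast; ring), rootVec]

theorem E_last_pred_zero :
    (E (n + 1) n 0 : Yangian (n + 1) ℏ ε) = X (-1) (n : ZMod (n + 1)) 0 := by
  rw [E_eq_negRoot (k := 0) (by push_cast; ring), rootVec, ZMod.natCast_self, natCast_last]
  congr 1
  ring

/-- `E_{n,1} t`, the image of `X⁺_{0,0}`. -/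
theorem E_pred_one : (E n 1 1 : Yangian (n + 1) ℏ ε)
    = ⁅(X 1 (n : ZMod (n + 1)) 0 : Yangian (n + 1) ℏ ε), (X 1 0 0 : Yangian (n + 1) ℏ ε)⁆ := by
  rw [E_eq_posRoot (k := 1) (by push_cast; ring), rootVec, rootVec, natCast_last, neg_add_cancel]

/-- `E_{1,n} t⁻¹`, the image of `X⁻_{0,0}`. -/
theorem E_one_pred : (E 1 n (-1) : Yangian (n + 1) ℏ ε)
    = ⁅(X (-1) 0 0 : Yangian (n + 1) ℏ ε), (X (-1) (n : ZMod (n + 1)) 0 : Yangian (n + 1) ℏ ε)⁆ := by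
  rw [E_eq_negRoot (k := 1) (by push_cast; ring), rootVec, rootVec, natCast_last]
  simp

theorem exists_add_two_eq (hn : 3 ≤ n) (s : ℕ) : ∃ k : ℕ, k + 2 = (s + 1) * (n + 1) :=
  ⟨(s + 1) * (n + 1) - 2, Nat.sub_add_cancel (by nlinarith)⟩

section

variable (hn : 3 ≤ n) (s : ℕ)
include hn

local notation "Y" => Yangian (n + 1) ℏ ε

theorem lie_E_last_one_E_pred_one : ⁅(E (n + 1) 1 (s + 1) : Y), (E n 1 1 : Y)⁆ = 0 := by
  have := (isChevalley (n + 1) ℏ ε).lie_rootVec_lie_e_e (two_ne_zero_zmod hn) 0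
    (natCast_mul_last n s)
  rwa [zero_sub, ← natCast_last, ← E_last_one, ← E_pred_one] at this

theorem lie_E_last_two_E_pred_one : ⁅(E (n + 1) 2 (s + 1) : Y), (E n 1 1 : Y)⁆ = 0 := by
  have := (isChevalley (n + 1) ℏ ε).lie_rootVec_succ_lie_e_e (two_ne_zero_zmod hn) 0
    (natCast_mul_last n s) (three_ne_zero_zmod hn)
  rwa [zero_sub, ← natCast_last, ← E_last_two, ← E_pred_one] at this

theorem lie_E_last_two_E_one_pred : ⁅(E (n + 1) 2 (s + 1) : Y), (E 1 n (-1) : Y)⁆ = 0 := by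
  have := (isChevalley (n + 1) ℏ ε).lie_rootVec_succ_lie_f_f (two_ne_zero_zmod hn) 0
    (natCast_mul_last n s)
  rwa [zero_sub, ← natCast_last, ← E_last_two, ← E_one_pred] at this

theorem lie_E_two_last_E_pred_one : ⁅(E 2 (n + 1) (-s - 1) : Y), (E n 1 1 : Y)⁆ = 0 := by
  have := (isChevalley (n + 1) ℏ ε).mirror.lie_rootVec_sub_one_lie_f_f (two_ne_zero_zmod hn) 0
    (natCast_mul_last n s)
  rwa [zero_add, neg_zero, ← natCast_last, ← E_two_last, ← E_pred_one] at this

theorem lie_E_one_last_E_one_pred : ⁅(E 1 (n + 1) (-s - 1) : Y), (E 1 n (-1) : Y)⁆ = 0 := by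
  have := (isChevalley (n + 1) ℏ ε).mirror.lie_rootVec_lie_e_e' (two_ne_zero_zmod hn) 0
    (natCast_mul_last n s)
  rwa [zero_add, neg_zero, ← natCast_last, ← E_one_last, ← E_one_pred] at this

theorem lie_E_two_last_E_one_pred : ⁅(E 2 (n + 1) (-s - 1) : Y), (E 1 n (-1) : Y)⁆ = 0 := by
  have := (isChevalley (n + 1) ℏ ε).mirror.lie_rootVec_sub_one_lie_e_e (two_ne_zero_zmod hn) 0
    (natCast_mul_last n s) (three_ne_zero_zmod hn)
  rwa [zero_add, neg_zero, ← natCast_last, ← E_two_last, ← E_one_pred] at this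

theorem lie_E_one_last_E_pred_one :
    ⁅(E 1 (n + 1) (-s - 1) : Y), (E n 1 1 : Y)⁆ = -E n (n + 1) (-s) := by
  obtain _ | s := s
  · have := (isChevalley (n + 1) ℏ ε).lie_f_lie_e_e (two_ne_zero_zmod hn) 0
    rw [zero_sub, ← natCast_last, ← E_pred_one, ← E_pred_last_zero] at this
    rw [E_one_last, zero_mul, rootVec, neg_zero, this]
    simp
  · obtain ⟨k, hk⟩ := exists_add_two_eq hn s
    have := (isChevalley (n + 1) ℏ ε).mirror.lie_rootVec_lie_f_f' (two_ne_zero_zmod hn) 0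
      (by rw [hk]; exact natCast_mul_last n _)
    rw [hk, zero_add, neg_zero, ← natCast_last, ← E_one_last, ← E_pred_one] at this
    rw [this, ← E_pred_last hk]
    push_cast
    ring_nf

theorem lie_E_last_one_E_one_pred :
    ⁅(E (n + 1) 1 (s + 1) : Y), (E 1 n (-1) : Y)⁆ = E (n + 1) n s := by
  obtain _ | s := s
  · have := (isChevalley (n + 1) ℏ ε).lie_e_lie_f_f (two_ne_zero_zmod hn) 0
    rw [zero_sub, ← natCast_last, ← E_one_pred, ← E_last_pred_zero] at this
    rw [E_last_one, zero_mul, rootVec, this]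
    simp
  · obtain ⟨k, hk⟩ := exists_add_two_eq hn s
    have := (isChevalley (n + 1) ℏ ε).lie_rootVec_lie_f_f (two_ne_zero_zmod hn) 0
      (by rw [hk]; exact natCast_mul_last n _) 
    rw [hk, zero_sub, ← natCast_last, ← E_last_one, ← E_one_pred, ← E_last_pred hk] at this
    exact_mod_cast this

theorem lie_E_pred_last_E_one_pred :
    ⁅(E n (n + 1) (-s) : Y), (E 1 n (-1) : Y)⁆ = -E 1 (n + 1) (-s - 1) := by
  obtain _ | s := s
  · have := (isChevalley (n + 1) ℏ ε).lie_e_pred_lie_f_f (two_ne_zero_zmod hn) 0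
    rw [zero_sub, ← natCast_last, ← E_one_pred, ← E_pred_last_zero] at this
    rw [E_one_last, zero_mul, rootVec, neg_zero, ← this]
    simp
  · obtain ⟨k, hk⟩ := exists_add_two_eq hn s
    have := (isChevalley (n + 1) ℏ ε).mirror.lie_rootVec_add_two_lie_e_e (two_ne_zero_zmod hn) 0
      (by rw [hk]; exact natCast_mul_last n _)
    rw [hk, ← E_pred_last hk, zero_add, neg_zero, ← natCast_last, ← E_one_last,
      ← E_one_pred] at this
    rw [← this]
    push_cast
    ring_nf

end

end YangianBrackets

/-! ### Degrees and convergence -/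

section Convergence

variable {n : ℕ} {ℏ ε : ℂ}

theorem gen_mem_homog (g : Gen n) : (gen g : Yangian n ℏ ε) ∈ homog n ℏ ε (deg g) :=
  Submodule.subset_span ⟨[g], by simp, by simp⟩

theorem lie_mem_homog {d e : ℤ} {x y : Yangian n ℏ ε} (hx : x ∈ homog n ℏ ε d)
    (hy : y ∈ homog n ℏ ε e) : ⁅x, y⁆ ∈ homog n ℏ ε (d + e) := by
  rw [Ring.lie_def]
  exact sub_mem (homog_mul hx hy) (add_comm e d ▸ homog_mul hy hx)

/-- The number `a / n - (a - 1) / n` is `1` if `n ∣ a` and `0` otherwise; in this form the degrees of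
the factors of a root vector telescope. -/
theorem X_mem_homog (hn : 0 < n) (σ : ℤˣ) (a : ℤ) (r : Fin 2) :
    (X σ (a : ZMod n) r : Yangian n ℏ ε) ∈ homog n ℏ ε (σ * (a / n - (a - 1) / n)) := by
  have hn' : (0 : ℤ) < n := by exact_mod_cast hn
  have h := gen_mem_homog (ℏ := ℏ) (ε := ε) (Gen.X σ (a : ZMod n) r)
  change gen _ ∈ _
  convert h using 2
  simp only [deg, ZMod.intCast_zmod_eq_zero_iff_dvd]
  split_ifs with hd
  · obtain ⟨c, rfl⟩ := hd
    have : (n * c - 1 : ℤ) / n = c - 1 :=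
      ((Int.ediv_emod_unique (r := n - 1) hn').2 ⟨by ring, by omega, by omega⟩).1
    rw [this, Int.mul_ediv_cancel_left _ hn'.ne']
    ring
  · have h1 := Int.emod_nonneg a hn'.ne'
    have h2 := Int.emod_lt_of_pos a hn'
    have h3 : a % n ≠ 0 := fun h => hd (Int.dvd_of_emod_eq_zero h)
    have : (a - 1) / n = a / n :=
      ((Int.ediv_emod_unique (r := a % n - 1) hn').2
        ⟨by linear_combination Int.emod_add_mul_ediv a n, by omega, by omega⟩).1
    rw [this, sub_self, mul_zero]

theorem posRoot_mem_homog (hn : 0 < n) (a : ℤ) (k : ℕ) :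
    (posRoot (a : ZMod n) k : Yangian n ℏ ε) ∈ homog n ℏ ε ((a + k) / n - (a - 1) / n) := by
  induction k generalizing a with
  | zero => simpa [posRoot] using X_mem_homog (ℏ := ℏ) (ε := ε) hn 1 a 0
  | succ k ih =>
    have h := lie_mem_homog (X_mem_homog (ℏ := ℏ) (ε := ε) hn 1 a 0) (ih (a + 1))
    rw [posRoot]
    convert h using 1
    · congr 1
      rw [add_sub_cancel_right, add_right_comm, add_assoc]
      push_cast
      ring
    · push_cast; rfl

theorem negRoot_mem_homog (hn : 0 < n) (a : ℤ) (k : ℕ) :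
    (negRoot (a : ZMod n) k : Yangian n ℏ ε) ∈ homog n ℏ ε (-((a + k) / n - (a - 1) / n)) := by
  induction k with
  | zero => simpa [negRoot] using X_mem_homog (ℏ := ℏ) (ε := ε) hn (-1) a 0
  | succ k ih =>
    have h := lie_mem_homog (X_mem_homog (ℏ := ℏ) (ε := ε) hn (-1) (a + ((k + 1 : ℕ) : ℤ)) 0) ih
    rw [negRoot]
    convert h using 1
    · congr 1
      rw [show (a + ((k + 1 : ℕ) : ℤ) - 1) = a + k by push_cast; ring]
      push_cast
      ring
    · push_cast; rfl

/-- `E_{i,j} t^s` has degree `s`. -/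
theorem E_mem_homog {i j : ℕ} (hi : 1 ≤ i) (hin : i ≤ n) (hj : 1 ≤ j) (hjn : j ≤ n) (hij : i ≠ j)
    (s : ℤ) : (E i j s : Yangian n ℏ ε) ∈ homog n ℏ ε s := by
  have hn : 0 < n := by omega
  have hn' : (0 : ℤ) < n := by exact_mod_cast hn
  have hi0 : ((i : ℤ) - 1) / n = 0 := Int.ediv_eq_zero_of_lt (by omega) (by omega)
  have hjs : (j + s * n - 1 : ℤ) / n = s :=
    ((Int.ediv_emod_unique (r := j - 1) hn').2 ⟨by ring, by omega, by omega⟩).1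
  rw [E]
  split_ifs with h
  · have := posRoot_mem_homog (ℏ := ℏ) (ε := ε) hn i (j + s * n - i - 1 : ℤ).toNat
    rw [Int.toNat_of_nonneg (by omega),
      show (i + (j + s * n - i - 1) : ℤ) = j + s * n - 1 by ring, hjs, hi0, sub_zero] at this
    exact_mod_cast this
  · have hne : (i : ℤ) ≠ j + s * n := by
      intro h1
      rw [← h1, hi0] at hjs
      rw [← hjs] at h1
      omega
    have := negRoot_mem_homog (ℏ := ℏ) (ε := ε) hn (j + s * n) (i - (j + s * n) - 1 : ℤ).toNat
    rw [Int.toNat_of_nonneg (by omega),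
      show (j + s * n + (i - (j + s * n) - 1) : ℤ) = i - 1 by ring, hjs, hi0, zero_sub,
      neg_neg] at this
    exact this

/-- A series of products `u_s v_s` of a fixed degree, in which the degree of the right factors `v_s`
tends to infinity, converges in the degreewise completion. -/
theorem summable_mul_toCompl {d : ℤ} {r : ℕ → ℤ} (hr : ∀ s : ℕ, (s : ℤ) ≤ r s)
    {u v : ℕ → Yangian n ℏ ε} (hu : ∀ s, u s ∈ homog n ℏ ε (d - r s))
    (hv : ∀ s, v s ∈ homog n ℏ ε (r s)) : Summable fun s => toCompl (u s) * toCompl (v s) := by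
  have hsum : Summable fun s => toFull (u s * v s) := by
    refine summable_iff_vanishing.2 fun e he => ?_
    have hc : Continuous (toFull : Yangian n ℏ ε → FullCompletion n ℏ ε) :=
      UniformSpace.Completion.continuous_coe _
    have he' : (toFull : Yangian n ℏ ε → FullCompletion n ℏ ε) ⁻¹' e ∈ 𝓝 0 :=
      hc.continuousAt.preimage_mem_nhds (by rwa [map_zero])
    obtain ⟨N, -, hN⟩ := (basis n ℏ ε).hasBasis_nhds_zero.mem_iff.1 he'
    refine ⟨Finset.range N, fun t ht => ?_⟩
    rw [← map_sum]
    refine hN ((leftIdeal n ℏ ε N).sum_mem fun s hs => Ideal.mul_mem_left _ _ ?_)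
    have hs' : N ≤ s := by
      have := Finset.disjoint_left.1 ht hs
      simpa using this
    exact Submodule.subset_span (Set.mem_iUnion.2 ⟨⟨r s, by have := hr s; omega⟩, hv s⟩)
  obtain ⟨a, ha⟩ := hsum
  have hmem : a ∈ homogCompl n ℏ ε d := by
    have hcl : IsClosed (homogCompl n ℏ ε d : Set (FullCompletion n ℏ ε)) := isClosed_closure
    refine hcl.mem_of_tendsto ha (.of_forall fun t => sum_mem fun s _ => subset_closure ⟨_, ?_, rfl⟩)
    simpa using homog_mul (hu s) (hv s)
  refine ⟨⟨a, Submodule.mem_iSup_of_mem d hmem⟩, ?_⟩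
  refine (Topology.IsInducing.subtypeVal.hasSum_iff
    (g := (CompletedYangian n ℏ ε).val) (fun s => toCompl (u s) * toCompl (v s)) _).1 ?_
  convert ha using 2 with s
  · rw [Function.comp_apply, map_mul, map_mul]; rfl
  · rfl

theorem summable_cE_mul_cE {i j i' j' : ℕ} (hi : 1 ≤ i) (hin : i ≤ n) (hj : 1 ≤ j) (hjn : j ≤ n)
    (hij : i ≠ j) (hi' : 1 ≤ i') (hin' : i' ≤ n) (hj' : 1 ≤ j') (hjn' : j' ≤ n) (hij' : i' ≠ j')
    {d : ℤ} {p r : ℕ → ℤ} (hp : ∀ s, p s + r s = d) (hr : ∀ s : ℕ, (s : ℤ) ≤ r s) :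
    Summable fun s => (cE i j (p s) * cE i' j' (r s) : CompletedYangian n ℏ ε) :=
  summable_mul_toCompl hr (fun s => by
    rw [show d - r s = p s by rw [← hp s]; ring]; exact E_mem_homog hi hin hj hjn hij _)
    fun s => E_mem_homog hi' hin' hj' hjn' hij' _

end Convergence

/-! ### Level-one elements of the Yangian -/

section LevelOne

attribute [local instance 100] LieRing.ofAssociativeRing

theorem mul_lie_eq {R : Type*} [Ring R] (a b y : R) : ⁅a * b, y⁆ = a * ⁅b, y⁆ + ⁅a, y⁆ * b := by
  simp only [Ring.lie_def]
  noncomm_ring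

variable {n : ℕ} {ℏ ε : ℂ}

local notation "Y" => Yangian (n + 1) ℏ ε

theorem lie_Ht_one_X_zero (hn : 3 ≤ n) (σ : ℤˣ) :
    ⁅(Ht 1 : Y), (X σ 0 0 : Y)⁆ = -(sgn σ • X σ 0 1) := by
  have h1 : (1 : ZMod (n + 1)) ≠ 0 := fun h => two_ne_zero_zmod hn (by linear_combination 2 * h)
  have h2 : (1 : ZMod (n + 1)) ≠ -1 := fun h => two_ne_zero_zmod hn (by linear_combination h)
  have h := mk_rel (Relation.HtX (n := n + 1) (ℏ := ℏ) (ε := ε) σ 1 0 (by simp [h1]) (by simp [h2]))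
  have hc : cartan (n + 1) 1 0 = -1 := by simp [cartan, h1]
  rw [mk_lie, mk_fHt, map_smul, hc] at h
  change ⁅Ht 1, (X σ 0 0 : Y)⁆ = _ • (X σ 0 1 : Y) at h
  rw [h]
  simp

theorem lie_Ht_one_X_last (hn : 3 ≤ n) (σ : ℤˣ) :
    ⁅(Ht 1 : Y), (X σ (n : ZMod (n + 1)) 0 : Y)⁆ = 0 := by
  have h1 : (1 : ZMod (n + 1)) ≠ 0 := fun h => two_ne_zero_zmod hn (by linear_combination 2 * h)
  have h2 : (1 : ZMod (n + 1)) ≠ -1 := fun h => two_ne_zero_zmod hn (by linear_combination h)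
  have h := mk_rel (Relation.HtX (n := n + 1) (ℏ := ℏ) (ε := ε) σ 1 (-1) (by simp [h1])
    (by simp [h2]))
  have hc : cartan (n + 1) 1 (-1) = 0 := by
    have h3 : (-1 : ZMod (n + 1)) ≠ 1 + 1 := fun h =>
      three_ne_zero_zmod hn (by linear_combination -h)
    simp [cartan, h1, h2, h3]
  rw [mk_lie, mk_fHt, map_smul, hc] at h
  rw [natCast_last]
  change ⁅Ht 1, (X σ (-1) 0 : Y)⁆ = _ • (X σ (-1) 1 : Y) at h
  rw [h]
  simp

theorem lie_Ht_one_E_pred_one (hn : 3 ≤ n) : ⁅(Ht 1 : Y), (E n 1 1 : Y)⁆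
    = -⁅(X 1 (n : ZMod (n + 1)) 0 : Y), (X 1 0 1 : Y)⁆ := by
  rw [E_pred_one, leibniz_lie, lie_Ht_one_X_last hn, lie_Ht_one_X_zero hn]
  simp [sgn]

theorem lie_Ht_one_E_one_pred (hn : 3 ≤ n) : ⁅(Ht 1 : Y), (E 1 n (-1) : Y)⁆
    = ⁅(X (-1) 0 1 : Y), (X (-1) (n : ZMod (n + 1)) 0 : Y)⁆ := by
  rw [E_one_pred, leibniz_lie, lie_Ht_one_X_last hn, lie_Ht_one_X_zero hn]
  simp [sgn]

/-- `[X⁺_{n,0}, H_{0,1}]`. -/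
theorem lie_X_last_H_zero_one (hn : 3 ≤ n) :
    ⁅(X 1 (n : ZMod (n + 1)) 0 : Y), (H 0 1 : Y)⁆
      = X 1 (n : ZMod (n + 1)) 1 + (ε + ((n : ℂ) + 1) / 2 * ℏ) • X 1 (n : ZMod (n + 1)) 0
        + (ℏ / 2) • (H 0 0 * X 1 (n : ZMod (n + 1)) 0 + X 1 (n : ZMod (n + 1)) 0 * H 0 0) := by
  have h1 : (1 : ZMod (n + 1)) ≠ 0 := fun h => two_ne_zero_zmod hn (by linear_combination 2 * h)
  have h := mk_rel (Relation.HtX_zero_last (n := n + 1) (ℏ := ℏ) (ε := ε) 1)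
  rw [mk_lie, mk_fHt, map_neg, map_smul, map_add, map_smul] at h
  change ⁅Ht 0, (X 1 (-1) 0 : Y)⁆ = -(_ • (X 1 (-1) 1 + _ • X 1 (-1) 0) : Y) at h
  have h0 := (isChevalley (n + 1) ℏ ε).lie_h_e 0 (-1)
  have hc : cartan (n + 1) 0 (-1) = -1 := by simp [cartan, h1]
  rw [hc] at h0
  rw [← natCast_last] at h h0
  rw [Ht, sub_lie, smul_lie, sq, mul_lie_eq, h0, ← lie_skew, sub_eq_iff_eq_add] at h
  rw [← neg_inj, h]
  simp only [sgn, Units.val_one, Int.cast_one, one_smul, Int.cast_neg, neg_smul, mul_neg, neg_mul]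
  push_cast
  module

/-- `[[X⁺_{n,0}, X⁺_{0,1}], E_{1,n} t⁻¹]`. -/
theorem lie_lie_X_last_X_zero_E_one_pred (hn : 3 ≤ n) :
    ⁅⁅(X 1 (n : ZMod (n + 1)) 0 : Y), (X 1 0 1 : Y)⁆, (E 1 n (-1) : Y)⁆
      = H 0 1 + H (n : ZMod (n + 1)) 1 + (ε + ℏ / 2 * (n : ℂ)) • H (n : ZMod (n + 1)) 0
        + ℏ • (H (n : ZMod (n + 1)) 0 * H 0 0)
        + ℏ • (X 1 (n : ZMod (n + 1)) 0 * X (-1) (n : ZMod (n + 1)) 0) := by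
  have h1 : (1 : ZMod (n + 1)) ≠ 0 := fun h => two_ne_zero_zmod hn (by linear_combination 2 * h)
  have T := isChevalley (n + 1) ℏ ε
  have rXX : ∀ i j : ZMod (n + 1), ⁅(X 1 i 1 : Y), (X (-1) j 0 : Y)⁆
      = if i = j then H i 1 else 0 := by
    intro i j
    have h := mk_rel (Relation.XX10 (n := n + 1) (ℏ := ℏ) (ε := ε) i j)
    rw [mk_lie, apply_ite mk, map_zero] at h
    exact h
  have hXX : ⁅(X 1 (n : ZMod (n + 1)) 0 : Y), (X (-1) (n : ZMod (n + 1)) 0 : Y)⁆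
      = H (n : ZMod (n + 1)) 0 := by
    have := T.lie_e_f (n : ZMod (n + 1)) n
    rwa [if_pos rfl] at this
  have hn0 : (n : ZMod (n + 1)) ≠ 0 := by rw [natCast_last]; simpa using h1
  have hXX' : ⁅(X 1 (n : ZMod (n + 1)) 0 : Y), (X (-1) 0 0 : Y)⁆ = 0 := by
    have := T.lie_e_f (n : ZMod (n + 1)) 0
    rwa [if_neg hn0] at this
  have hHX : ⁅(H (n : ZMod (n + 1)) 0 : Y), (X 1 0 1 : Y)⁆ = -X 1 0 1 := by
    have h := mk_rel (Relation.HX (n := n + 1) (ℏ := ℏ) (ε := ε) 1 n 0 1)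
    rw [mk_lie, map_smul, show cartan (n + 1) n 0 = -1 by simp [cartan, natCast_last, h1]] at h
    change ⁅H _ 0, (X 1 0 1 : Y)⁆ = _ • (X 1 0 1 : Y) at h
    rw [h]
    simp [sgn]
  have hHX' : ⁅(H 0 0 : Y), (X (-1) (n : ZMod (n + 1)) 0 : Y)⁆
      = X (-1) (n : ZMod (n + 1)) 0 := by
    have h := T.lie_h_f 0 n
    rw [h, show cartan (n + 1) 0 n = -1 by simp [cartan, natCast_last, h1]]
    simp
  have hHH : (H 0 0 * H (n : ZMod (n + 1)) 0 : Y)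
      = H (n : ZMod (n + 1)) 0 * H 0 0 := by
    have h := mk_rel (Relation.HH (n := n + 1) (ℏ := ℏ) (ε := ε) 0 n 0 0)
    rw [mk_lie, map_zero, Ring.lie_def, sub_eq_zero] at h
    exact h
  have hDA : (X (-1) (n : ZMod (n + 1)) 0 * X 1 (n : ZMod (n + 1)) 0 : Y)
      = X 1 (n : ZMod (n + 1)) 0 * X (-1) (n : ZMod (n + 1)) 0 - H (n : ZMod (n + 1)) 0 := by
    rw [← hXX, Ring.lie_def, sub_sub_cancel]
  rw [E_one_pred, leibniz_lie, lie_lie (X 1 (n : ZMod (n + 1)) 0 : Y) _ (X (-1) 0 0),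
    lie_lie (X 1 (n : ZMod (n + 1)) 0 : Y) _ (X (-1) (n : ZMod (n + 1)) 0),
    rXX, rXX, if_pos rfl, if_neg hn0.symm, hXX, hXX', lie_zero, sub_zero, lie_zero, zero_sub,
    lie_skew, hHX, lie_neg, lie_skew (X 1 0 1 : Y), lie_X_last_H_zero_one hn]
  simp only [add_lie, smul_lie, mul_lie_eq, rXX, hXX, hHX', if_true, hHH, hDA]
  module

end LevelOne

/-! ### Level-one values of `Ψ` -/

section Values

section Series

variable {A : Type*} [Ring A] [TopologicalSpace A] [IsTopologicalRing A]

/-- Bracketing with a fixed element is continuous, so it passes through convergent series. -/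
theorem hasSum_lie_right {f : ℕ → A} {a : A} (hf : HasSum f a) (y : A) :
    HasSum (fun s => ⁅f s, y⁆) ⁅a, y⁆ := by
  simp only [Ring.lie_def]
  exact (hf.mul_right y).sub (hf.mul_left y)

end Series

instance (n : ℕ) (ℏ ε : ℂ) : IsTopologicalRing (CompletedYangian n ℏ ε) :=
  inferInstanceAs (IsTopologicalRing (CompletedYangian n ℏ ε).toSubring)

variable {n : ℕ} {ℏ ε : ℂ}

theorem toCompl_lie (x y : Yangian n ℏ ε) :
    toCompl ⁅x, y⁆ = ⁅(toCompl x : CompletedYangian n ℏ ε), (toCompl y : CompletedYangian n ℏ ε)⁆ := by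
  rw [Ring.lie_def, Ring.lie_def, map_sub, map_mul, map_mul]

local notation "C" => CompletedYangian (n + 1) ℏ ε

section

variable (hn : 3 ≤ n)
include hn

theorem summable_one_last_mul_last_one :
    Summable fun s : ℕ => (cE 1 (n + 1) (-(s : ℤ) - 1) * cE (n + 1) 1 ((s : ℤ) + 1) : C) :=
  summable_cE_mul_cE (d := 0) (by omega) (by omega) (by omega) (by omega) (by omega) (by omega)
    (by omega) (by omega) (by omega) (by omega) (fun s => by ring) (fun s => by omega)

theorem summable_two_last_mul_last_two :
    Summable fun s : ℕ => (cE 2 (n + 1) (-(s : ℤ) - 1) * cE (n + 1) 2 ((s : ℤ) + 1) : C) :=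
  summable_cE_mul_cE (d := 0) (by omega) (by omega) (by omega) (by omega) (by omega) (by omega)
    (by omega) (by omega) (by omega) (by omega) (fun s => by ring) (fun s => by omega)

theorem summable_pred_last_mul_last_pred :
    Summable fun s : ℕ => (cE n (n + 1) (-(s : ℤ) - 1) * cE (n + 1) n ((s : ℤ) + 1) : C) :=
  summable_cE_mul_cE (d := 0) (by omega) (by omega) (by omega) (by omega) (by omega) (by omega)
    (by omega) (by omega) (by omega) (by omega) (fun s => by ring) (fun s => by omega)

theorem summable_pred_last_mul_last_one :
    Summable fun s : ℕ => (cE n (n + 1) (-(s : ℤ)) * cE (n + 1) 1 ((s : ℤ) + 1) : C) :=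
  summable_cE_mul_cE (d := 1) (by omega) (by omega) (by omega) (by omega) (by omega) (by omega)
    (by omega) (by omega) (by omega) (by omega) (fun s => by ring) (fun s => by omega)

theorem summable_one_last_mul_last_pred :
    Summable fun s : ℕ => (cE 1 (n + 1) (-(s : ℤ) - 1) * cE (n + 1) n (s : ℤ) : C) :=
  summable_cE_mul_cE (d := -1) (by omega) (by omega) (by omega) (by omega) (by omega) (by omega)
    (by omega) (by omega) (by omega) (by omega) (fun s => by ring) (fun s => by omega)

theorem lie_tsum_one_E_pred_one :
    ⁅(∑' s : ℕ, cE 1 (n + 1) (-(s : ℤ) - 1) * cE (n + 1) 1 ((s : ℤ) + 1) : C), (cE n 1 1 : C)⁆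
      = -∑' s : ℕ, cE n (n + 1) (-(s : ℤ)) * cE (n + 1) 1 ((s : ℤ) + 1) := by
  refine ((hasSum_lie_right (summable_one_last_mul_last_one hn).hasSum _).tsum_eq.symm.trans ?_).trans
    tsum_neg
  refine tsum_congr fun s => ?_
  rw [mul_lie_eq, cE, cE, cE, cE, ← toCompl_lie, ← toCompl_lie, lie_E_last_one_E_pred_one hn,
    lie_E_one_last_E_pred_one hn, map_zero, mul_zero, zero_add, map_neg, neg_mul]

theorem lie_tsum_two_E_pred_one :
    ⁅(∑' s : ℕ, cE 2 (n + 1) (-(s : ℤ) - 1) * cE (n + 1) 2 ((s : ℤ) + 1) : C), (cE n 1 1 : C)⁆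
      = 0 := by
  refine (hasSum_lie_right (summable_two_last_mul_last_two hn).hasSum _).tsum_eq.symm.trans ?_
  refine (tsum_congr fun s => ?_).trans tsum_zero
  rw [mul_lie_eq, cE, cE, cE, ← toCompl_lie, ← toCompl_lie, lie_E_last_two_E_pred_one hn,
    lie_E_two_last_E_pred_one hn, map_zero, mul_zero, zero_mul, zero_add]

theorem lie_tsum_one_E_one_pred :
    ⁅(∑' s : ℕ, cE 1 (n + 1) (-(s : ℤ) - 1) * cE (n + 1) 1 ((s : ℤ) + 1) : C), (cE 1 n (-1) : C)⁆
      = ∑' s : ℕ, cE 1 (n + 1) (-(s : ℤ) - 1) * cE (n + 1) n (s : ℤ) := by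
  refine (hasSum_lie_right (summable_one_last_mul_last_one hn).hasSum _).tsum_eq.symm.trans ?_
  refine tsum_congr fun s => ?_
  rw [mul_lie_eq, cE, cE, cE, cE, ← toCompl_lie, ← toCompl_lie, lie_E_last_one_E_one_pred hn,
    lie_E_one_last_E_one_pred hn, map_zero, zero_mul, add_zero]

theorem lie_tsum_two_E_one_pred :
    ⁅(∑' s : ℕ, cE 2 (n + 1) (-(s : ℤ) - 1) * cE (n + 1) 2 ((s : ℤ) + 1) : C), (cE 1 n (-1) : C)⁆
      = 0 := by
  refine (hasSum_lie_right (summable_two_last_mul_last_two hn).hasSum _).tsum_eq.symm.trans ?_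
  refine (tsum_congr fun s => ?_).trans tsum_zero
  rw [mul_lie_eq, cE, cE, cE, ← toCompl_lie, ← toCompl_lie, lie_E_last_two_E_one_pred hn,
    lie_E_two_last_E_one_pred hn, map_zero, mul_zero, zero_mul, zero_add]

/-- The series `∑ E_{n,n+1} t^{-s} E_{n+1,n} t^s` that comes out of the left-hand side starts at
`s = 0` with `X⁺_{n,0} X⁻_{n,0}`, which is split off. -/
theorem lie_tsum_pred_E_one_pred :
    ⁅(∑' s : ℕ, cE n (n + 1) (-(s : ℤ)) * cE (n + 1) 1 ((s : ℤ) + 1) : C), (cE 1 n (-1) : C)⁆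
      = cX 1 (n : ZMod (n + 1)) 0 * cX (-1) (n : ZMod (n + 1)) 0
        + (∑' s : ℕ, cE n (n + 1) (-(s : ℤ) - 1) * cE (n + 1) n ((s : ℤ) + 1))
        - ∑' s : ℕ, cE 1 (n + 1) (-(s : ℤ) - 1) * cE (n + 1) 1 ((s : ℤ) + 1) := by
  have h0 : Summable fun s : ℕ => (cE n (n + 1) (-(s : ℤ)) * cE (n + 1) n (s : ℤ) : C) :=
    summable_cE_mul_cE (d := 0) (by omega) (by omega) (by omega) (by omega) (by omega) (by omega)
      (by omega) (by omega) (by omega) (by omega) (fun s => by ring) (fun s => by omega)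
  have h1 := h0.tsum_eq_zero_add
  simp only [Nat.cast_add, Nat.cast_one, neg_add, ← sub_eq_add_neg, Nat.cast_zero, neg_zero] at h1
  have h2 : (cE n (n + 1) 0 * cE (n + 1) n 0 : C)
      = cX 1 (n : ZMod (n + 1)) 0 * cX (-1) (n : ZMod (n + 1)) 0 := by
    rw [cE, cE, E_pred_last_zero, E_last_pred_zero]; rfl
  rw [← h2, ← h1, ← h0.tsum_sub (summable_one_last_mul_last_one hn)]
  refine (hasSum_lie_right (summable_pred_last_mul_last_one hn).hasSum _).tsum_eq.symm.trans ?_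
  refine tsum_congr fun s => ?_
  rw [mul_lie_eq, cE, cE, cE, cE, cE, ← toCompl_lie, ← toCompl_lie, lie_E_last_one_E_one_pred hn,
    lie_E_pred_last_E_one_pred hn, map_neg, neg_mul, ← sub_eq_add_neg]

end

variable {Ψ : Yangian n ℏ ε →ₐ[ℂ] CompletedYangian (n + 1) ℏ ε}

/-- The value of `Ψ` on `H̃_{1,1}`, the element whose brackets with `X^±_{0,0}` give `X^±_{0,1}`. -/
theorem IsPsi.map_Ht_one (hn : 3 ≤ n) (hΨ : IsPsi n ℏ ε Ψ) :
    Ψ (H 1 1 - (ℏ / 2) • H 1 0 ^ 2) = cHt 1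
      - ℏ • (∑' s : ℕ, cE 1 (n + 1) (-(s : ℤ) - 1) * cE (n + 1) 1 ((s : ℤ) + 1))
      + ℏ • ∑' s : ℕ, cE 2 (n + 1) (-(s : ℤ) - 1) * cE (n + 1) 2 ((s : ℤ) + 1) := by
  have h0 := hΨ.H_zero 1 le_rfl (by omega)
  have h1 := hΨ.H_one 1 le_rfl (by omega)
  rw [Nat.cast_one, Nat.cast_one] at h0 h1
  rw [map_sub, map_smul, map_pow, h0, h1, cHt, Ht, map_sub, map_smul, map_pow]
  simp only [cH]
  abel

theorem IsPsi.map_X_zero_one (hn : 3 ≤ n) (hΨ : IsPsi n ℏ ε Ψ) :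
    Ψ (X 1 0 1) = ⁅(cX 1 (n : ZMod (n + 1)) 0 : C), (cX 1 0 1 : C)⁆
      - ℏ • ∑' s : ℕ, cE n (n + 1) (-(s : ℤ)) * cE (n + 1) 1 ((s : ℤ) + 1) := by
  rw [X_zero_one hn, ← Ring.lie_def, sgn, Units.val_one, Int.cast_one, one_smul, map_neg,
    Ring.lie_def, map_sub, map_mul, map_mul, ← Ring.lie_def, hΨ.map_Ht_one hn, hΨ.Xp_zero_zero]
  have h1 := congrArg (toCompl (n := n + 1) (ℏ := ℏ) (ε := ε)) (lie_Ht_one_E_pred_one hn)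
  rw [toCompl_lie, map_neg, toCompl_lie] at h1
  change ⁅(cHt 1 : C), (cE n 1 1 : C)⁆ = -⁅(cX 1 (n : ZMod (n + 1)) 0 : C), (cX 1 0 1 : C)⁆ at h1
  have h2 := lie_tsum_one_E_pred_one (ℏ := ℏ) (ε := ε) hn
  have h3 := lie_tsum_two_E_pred_one (ℏ := ℏ) (ε := ε) hn
  simp only [Ring.lie_def] at h1 h2 h3 ⊢
  simp only [add_mul, sub_mul, mul_add, mul_sub, smul_mul_assoc, mul_smul_comm]
  linear_combination (norm := module) -h1 + ℏ • h2 - ℏ • h3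

theorem IsPsi.map_X_neg_zero_one (hn : 3 ≤ n) (hΨ : IsPsi n ℏ ε Ψ) :
    Ψ (X (-1) 0 1) = ⁅(cX (-1) 0 1 : C), (cX (-1) (n : ZMod (n + 1)) 0 : C)⁆
      - ℏ • ∑' s : ℕ, cE 1 (n + 1) (-(s : ℤ) - 1) * cE (n + 1) n (s : ℤ) := by
  rw [X_zero_one hn, sgn, Units.val_neg, Units.val_one, Int.cast_neg, Int.cast_one, neg_smul,
    one_smul, neg_neg, map_sub, map_mul, map_mul, hΨ.map_Ht_one hn, hΨ.Xm_zero_zero]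
  have h1 := congrArg (toCompl (n := n + 1) (ℏ := ℏ) (ε := ε)) (lie_Ht_one_E_one_pred hn)
  rw [toCompl_lie, toCompl_lie] at h1
  change ⁅(cHt 1 : C), (cE 1 n (-1) : C)⁆
    = ⁅(cX (-1) 0 1 : C), (cX (-1) (n : ZMod (n + 1)) 0 : C)⁆ at h1
  have h2 := lie_tsum_one_E_one_pred (ℏ := ℏ) (ε := ε) hn
  have h3 := lie_tsum_two_E_one_pred (ℏ := ℏ) (ε := ε) hn
  simp only [Ring.lie_def] at h1 h2 h3 ⊢
  simp only [add_mul, sub_mul, mul_add, mul_sub, smul_mul_assoc, mul_smul_comm]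
  linear_combination (norm := module) h1 - ℏ • h2 + ℏ • h3

theorem IsPsi.map_H_zero_one (hn : 3 ≤ n) (hΨ : IsPsi n ℏ ε Ψ) :
    Ψ (H 0 1) = cH 0 1 + cH (n : ZMod (n + 1)) 1
      + (ε + ℏ / 2 * (n : ℂ)) • cH (n : ZMod (n + 1)) 0
      + ℏ • (cH (n : ZMod (n + 1)) 0 * cH 0 0)
      - ℏ • ∑' s : ℕ, cE n (n + 1) (-(s : ℤ) - 1) * cE (n + 1) n ((s : ℤ) + 1)
      + ℏ • ∑' s : ℕ, cE 1 (n + 1) (-(s : ℤ) - 1) * cE (n + 1) 1 ((s : ℤ) + 1) := by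
  rw [H_zero_one, map_sub, map_mul, map_mul, hΨ.map_X_zero_one hn, hΨ.Xm_zero_zero]
  have h1 := congrArg (toCompl (n := n + 1) (ℏ := ℏ) (ε := ε))
    (lie_lie_X_last_X_zero_E_one_pred hn)
  rw [toCompl_lie, toCompl_lie] at h1
  simp only [map_add, map_smul, map_mul] at h1
  change ⁅⁅(cX 1 (n : ZMod (n + 1)) 0 : C), (cX 1 0 1 : C)⁆, (cE 1 n (-1) : C)⁆
    = cH 0 1 + cH (n : ZMod (n + 1)) 1 + (ε + ℏ / 2 * (n : ℂ)) • cH (n : ZMod (n + 1)) 0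
      + ℏ • (cH (n : ZMod (n + 1)) 0 * cH 0 0)
      + ℏ • (cX 1 (n : ZMod (n + 1)) 0 * cX (-1) (n : ZMod (n + 1)) 0) at h1
  have h2 := lie_tsum_pred_E_one_pred (ℏ := ℏ) (ε := ε) hn
  rw [Ring.lie_def _ (cE 1 n (-1))] at h1 h2
  simp only [sub_mul, mul_sub, smul_mul_assoc, mul_smul_comm] at h1 ⊢
  linear_combination (norm := module) h1 - ℏ • h2

theorem IsPsi.map_Ht_zero (hn : 3 ≤ n) (hΨ : IsPsi n ℏ ε Ψ) :
    Ψ (Ht 0) = cHt 0 + cHt (n : ZMod (n + 1))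
      + (ε + ℏ / 2 * (n : ℂ)) • cH (n : ZMod (n + 1)) 0
      - ℏ • ∑' s : ℕ, cE n (n + 1) (-(s : ℤ) - 1) * cE (n + 1) n ((s : ℤ) + 1)
      + ℏ • ∑' s : ℕ, cE 1 (n + 1) (-(s : ℤ) - 1) * cE (n + 1) 1 ((s : ℤ) + 1) := by
  have hHH : (cH 0 0 * cH (n : ZMod (n + 1)) 0 : C) = cH (n : ZMod (n + 1)) 0 * cH 0 0 := by
    have h := mk_rel (Relation.HH (n := n + 1) (ℏ := ℏ) (ε := ε) 0 n 0 0)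
    rw [mk_lie, map_zero, Ring.lie_def, sub_eq_zero] at h
    have h' := congrArg (toCompl (n := n + 1) (ℏ := ℏ) (ε := ε)) h
    rw [map_mul, map_mul] at h'
    exact h'
  rw [Ht, map_sub, map_smul, map_pow, hΨ.map_H_zero_one hn, hΨ.H_zero_zero, cHt, cHt, Ht, Ht,
    map_sub, map_smul, map_pow, map_sub, map_smul, map_pow]
  change _ = cH 0 1 - (ℏ / 2) • cH 0 0 ^ 2
    + (cH (n : ZMod (n + 1)) 1 - (ℏ / 2) • cH (n : ZMod (n + 1)) 0 ^ 2) + _ - _ + _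
  rw [sq (cH 0 0 + _), add_mul, mul_add, mul_add, hHH, sq, sq]
  module

end Values

end AffineYangian

open AffineYangian in
theorem corollary3p2 (n : ℕ) (hn : 3 ≤ n) (ℏ ε : ℂ)
    (Ψ : Yangian n ℏ ε →ₐ[ℂ] CompletedYangian (n + 1) ℏ ε) (hΨ : IsPsi n ℏ ε Ψ) :
    -- the four infinite sums below converge in the degreewise completion
    (Summable (fun s : ℕ => (cE n (n + 1) (-(s : ℤ)) * cE (n + 1) 1 ((s : ℤ) + 1) :
        CompletedYangian (n + 1) ℏ ε)) ∧
      Summable (fun s : ℕ => (cE 1 (n + 1) (-(s : ℤ) - 1) * cE (n + 1) n (s : ℤ) :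
        CompletedYangian (n + 1) ℏ ε)) ∧
      Summable (fun s : ℕ => (cE n (n + 1) (-(s : ℤ) - 1) * cE (n + 1) n ((s : ℤ) + 1) :
        CompletedYangian (n + 1) ℏ ε)) ∧
      Summable (fun s : ℕ => (cE 1 (n + 1) (-(s : ℤ) - 1) * cE (n + 1) 1 ((s : ℤ) + 1) :
        CompletedYangian (n + 1) ℏ ε))) ∧
    Ψ (X 1 0 1) = ⁅(cX 1 (n : ZMod (n + 1)) 0 : CompletedYangian (n + 1) ℏ ε), cX 1 0 1⁆
      - ℏ • ∑' s : ℕ, cE n (n + 1) (-(s : ℤ)) * cE (n + 1) 1 ((s : ℤ) + 1) ∧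
    Ψ (X (-1) 0 1) = ⁅(cX (-1) 0 1 : CompletedYangian (n + 1) ℏ ε), cX (-1) (n : ZMod (n + 1)) 0⁆
      - ℏ • ∑' s : ℕ, cE 1 (n + 1) (-(s : ℤ) - 1) * cE (n + 1) n (s : ℤ) ∧
    Ψ (H 0 1) = cH 0 1 + cH (n : ZMod (n + 1)) 1
      + (ε + ℏ / 2 * (n : ℂ)) • cH (n : ZMod (n + 1)) 0
      + ℏ • (cH (n : ZMod (n + 1)) 0 * cH 0 0)
      - ℏ • ∑' s : ℕ, cE n (n + 1) (-(s : ℤ) - 1) * cE (n + 1) n ((s : ℤ) + 1)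
      + ℏ • ∑' s : ℕ, cE 1 (n + 1) (-(s : ℤ) - 1) * cE (n + 1) 1 ((s : ℤ) + 1) ∧
    Ψ (Ht 0) = cHt 0 + cHt (n : ZMod (n + 1))
      + (ε + ℏ / 2 * (n : ℂ)) • cH (n : ZMod (n + 1)) 0
      - ℏ • ∑' s : ℕ, cE n (n + 1) (-(s : ℤ) - 1) * cE (n + 1) n ((s : ℤ) + 1)
      + ℏ • ∑' s : ℕ, cE 1 (n + 1) (-(s : ℤ) - 1) * cE (n + 1) 1 ((s : ℤ) + 1) := 
  ⟨⟨summable_pred_last_mul_last_one hn, summable_one_last_mul_last_pred hn,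
    summable_pred_last_mul_last_pred hn, summable_one_last_mul_last_one hn⟩,
    hΨ.map_X_zero_one hn, hΨ.map_X_neg_zero_one hn, hΨ.map_H_zero_one hn, hΨ.map_Ht_zero hn⟩
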